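/- Let $p\ge 2$ be an integer, $\frac1p+\frac1q=1$, and let $\alpha\in\mathbb C$ satisfy $|e^{\alpha t x^p}|\le 1$ for all $x\in\mathbb R$, $t\ge 0$. For $t\ge 0$ and $r\in\{p,q\}$ let $\mathcal B_r$ be the space of absolutely continuous $\gamma:[0,t]\to\mathbb R$ with $\gamma(t)=0$ and $\dot\gamma\in L^r([0,t])$, normed by $\|\gamma\|=\|\dot\gamma\|_{L^r}$. Let $\mathcal F(\mathcal B_q)$ be the set of functions $f:\mathcal B_q\to\mathbb C$ of the form $f(\eta)=\int_{\mathcal B_p}e^{i\int_0^t\dot\eta(s)\dot\gamma(s)\,ds}\,d\mu(\gamma)$ with $\mu$ a complex Borel measure on $\mathcal B_p$; for such $f$ the infinite dimensional Fresnel integral with phase function $\Phi_p(\gamma)=(-1)^p\alpha\int_0^t\dot\gamma(s)^p\,ds$ is $$I_{\Phi_p}(f)=\int_{\mathcal B_p}e^{\Phi_p(\gamma)}\,d\mu(\gamma),$$ which does not depend on the choice of the representing measure $\mu$. Let $\mathcal F(\mathbb R)$ be the set of functions $x\mapsto\int_{\mathbb R}e^{ixy}\,d\nu(y)$ with $\nu$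 a complex Borel measure on $\mathbb R$. Let $V\in\mathcal F(\mathbb R)$, and let $B$ be multiplication by $V$ on $L^2(\mathbb R)$. Let $A=(-i)^p\alpha\,\partial_x^p$ be the operator on $L^2(\mathbb R)$ given by $\widehat{Au}(k)=\alpha k^p\hat u(k)$ on $D(A)=\{u\in L^2:\alpha k^p\hat u\in L^2\}$ (with $\hat u(k)=\int e^{-ikx}u(x)\,dx$). Then $A$ and $A+B$, with domain $D(A)$, generate strongly continuous semigroups $(e^{tA})_{t\ge0}$ and $(T(t))_{t\ge 0}$ on $L^2(\mathbb R)$. For every $u_0\in\mathcal F(\mathbb R)\cap L^2(\mathbb R)$ and every $t\ge 0$ the following hold. 1. For every $x\in\mathbb R$ the functional $f_{t,x}(\eta)=u_0(x+\eta(0))\exp\big(\int_0^tV(x+\eta(s))\,ds\big)$ on $\mathcal B_q$ belongs to $\mathcal F(\mathcal B_q)$. 2. $I_{\Phi_p}(f_{t,x})=(T(t)u_0)(x)$ for almost every $x$; that is, $I_{\Phi_p}(f_{t,x})$ is the ($L^2$ semigroup) solution of $\partial_tu=(-i)^p\alpha\,\partial_x^pu+Vu$, $u(0)=u_0$. 3.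 This solution is identified term by term with the Dyson series. Put $S_0(t)u_0=e^{tA}u_0$ and $S_{n+1}(t)u_0=\int_0^te^{(t-s)A}BS_n(s)u_0\,ds$. Then $T(t)u_0=\sum_{n\ge 0}S_n(t)u_0$ in $L^2(\mathbb R)$. For all $n\ge0$, $x\in\mathbb R$ and $0\le s_1\le\dots\le s_n\le t$ the functional $g_{x,s}(\eta)=u_0(x+\eta(0))V(x+\eta(s_1))\cdots V(x+\eta(s_n))$ belongs to $\mathcal F(\mathcal B_q)$, and $s\mapsto I_{\Phi_p}(g_{x,s})$ is integrable over the simplex. For every $x\in\mathbb R$ $$I_{\Phi_p}(f_{t,x})=\sum_{n=0}^\infty\ \int_{0\le s_1\le\dots\le s_n\le t}I_{\Phi_p}(g_{x,s})\,ds_1\cdots ds_n ,$$ and for every $n$ the $n$-th term of this sum, as a function of $x$, equals $S_n(t)u_0$ almost everywhere. -/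

import Mathlib

open MeasureTheory Set Filter Topology
open scoped ENNReal NNReal FourierTransform

noncomputable section

/-! ### Fourier transforms of complex measures and Fresnel integrals -/

/-- Integral of a complex function against a complex measure. -/
def cIntegral {E : Type*} [MeasurableSpace E] (μ : ComplexMeasure E) (f : E → ℂ) : ℂ :=
  VectorMeasure.integral μ f (ContinuousLinearMap.mul ℝ ℂ)

/-- Fourier transform `x ↦ ∫ exp (i ⟨x, y⟩) dμ(y)` of a complex measure on `E`, as a function on a
space `X` paired with `E`. -/
def measureFourier {X E : Type*} [MeasurableSpace E] (pair : X → E → ℝ) (μ : ComplexMeasure E)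
    (x : X) : ℂ :=
  cIntegral μ fun y => Complex.exp (Complex.I * (pair x y : ℂ))

/-- The class `F` of all Fourier transforms of complex measures (a complex measure automatically
has finite total variation). -/
def FourierClass {X E : Type*} [MeasurableSpace E] (pair : X → E → ℝ) : Set (X → ℂ) :=
  Set.range (measureFourier pair)

/-- The class `F(ℝ)`. -/
abbrev FourierClassReal : Set (ℝ → ℂ) := FourierClass fun x y : ℝ => x * y

open Classical in
/-- The Fresnel integral with phase function `Φ`: it is `∫ exp (Φ y) dμ(y)` if `f` is the Fourier
transform of `μ` (and `0` if `f` is not the Fourier transform of a complex measure). -/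
def fresnelIntegral {X E : Type*} [MeasurableSpace E] (pair : X → E → ℝ) (Φ : E → ℂ)
    (f : X → ℂ) : ℂ :=
  if h : f ∈ FourierClass pair then cIntegral h.choose fun y => Complex.exp (Φ y) else 0

/-! ### The path spaces `B_r` -/

/-- Extension of a function on `[0, t]` to the real line, constant on both sides. -/
def pathExtend {t : ℝ≥0} (γ : Icc (0 : ℝ) t → ℝ) : ℝ → ℝ := IccExtend t.coe_nonneg γ

/-- Absolutely continuous `γ : [0, t] → ℝ` with `γ t = 0` and derivative in `L^r([0, t])`. -/
def IsPath (r : ℝ≥0∞) {t : ℝ≥0} (γ : Icc (0 : ℝ) t → ℝ) : Prop :=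
  AbsolutelyContinuousOnInterval (pathExtend γ) 0 t ∧ γ ⟨t, right_mem_Icc.2 t.coe_nonneg⟩ = 0 ∧
    MemLp (deriv (pathExtend γ)) r (volume.restrict (Icc (0 : ℝ) t))

theorem pathExtend_add {t : ℝ≥0} (γ η : Icc (0 : ℝ) t → ℝ) :
    pathExtend (γ + η) = pathExtend γ + pathExtend η := rfl

theorem pathExtend_smul {t : ℝ≥0} (c : ℝ) (γ : Icc (0 : ℝ) t → ℝ) :
    pathExtend (c • γ) = c • pathExtend γ := rfl

theorem ae_deriv_add {t : ℝ≥0} {γ η : ℝ → ℝ} (hγ : AbsolutelyContinuousOnInterval γ 0 t)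
    (hη : AbsolutelyContinuousOnInterval η 0 t) :
    deriv (γ + η) =ᵐ[volume.restrict (Icc (0 : ℝ) t)] deriv γ + deriv η := by
  rw [Filter.EventuallyEq, ae_restrict_iff' measurableSet_Icc]
  filter_upwards [hγ.ae_differentiableAt, hη.ae_differentiableAt] with x h1 h2 hx
  rw [← uIcc_of_le t.coe_nonneg] at hx
  exact deriv_add (h1 hx) (h2 hx)

theorem deriv_smul_fun (c : ℝ) (γ : ℝ → ℝ) : deriv (c • γ) = c • deriv γ := by
  funext x
  exact deriv_const_smul_field c γ

/-- The vector space of all such paths. -/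
def pathSubmodule (r : ℝ≥0∞) (t : ℝ≥0) : Submodule ℝ (Icc (0 : ℝ) t → ℝ) where
  carrier := {γ | IsPath r γ}
  zero_mem' := by
    have h : pathExtend (0 : Icc (0 : ℝ) t → ℝ) = fun _ => 0 := rfl
    refine ⟨?_, rfl, ?_⟩
    · rw [h]
      exact ((LipschitzWith.const (0 : ℝ)).lipschitzOnWith (s := uIcc 0 (t : ℝ))).absolutelyContinuousOnInterval
    · rw [h]
      simp
  add_mem' := by
    rintro γ η ⟨h1, h2, h3⟩ ⟨k1, k2, k3⟩
    refine ⟨h1.add k1, by simp [h2, k2], ?_⟩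
    exact (memLp_congr_ae (ae_deriv_add h1 k1)).2 (h3.add k3)
  smul_mem' := by
    rintro c γ ⟨h1, h2, h3⟩
    refine ⟨h1.const_mul c, by simp [h2], ?_⟩
    rw [pathExtend_smul, deriv_smul_fun]
    exact h3.const_smul c

/-- The space `B_r` of absolutely continuous paths on `[0, t]` that vanish at `t` and have
derivative in `L^r([0, t])`. -/
def PathSpace (r : ℝ≥0∞) (t : ℝ≥0) : Type := pathSubmodule r t

namespace PathSpace

variable {r : ℝ≥0∞} {t : ℝ≥0}

instance : AddCommGroup (PathSpace r t) := inferInstanceAs (AddCommGroup (pathSubmodule r t))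

instance : Module ℝ (PathSpace r t) := inferInstanceAs (Module ℝ (pathSubmodule r t))

/-- The underlying function on `[0, t]`. -/
def toFun (γ : PathSpace r t) : Icc (0 : ℝ) t → ℝ := Subtype.val (p := (· ∈ pathSubmodule r t)) γ

theorem isPath (γ : PathSpace r t) : IsPath r γ.toFun :=
  Subtype.property (p := (· ∈ pathSubmodule r t)) γ

theorem toFun_injective : Function.Injective (toFun : PathSpace r t → _) := fun _ _ h =>
  Subtype.ext (p := (· ∈ pathSubmodule r t)) h

/-- The value `γ s` of a path (extended to the real line by constants). -/
def eval (γ : PathSpace r t) (s : ℝ) : ℝ := pathExtend γ.toFun s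

/-- The derivative of a path, defined almost everywhere on `[0, t]`. -/
def velocity (γ : PathSpace r t) : ℝ → ℝ := deriv (pathExtend γ.toFun)

theorem memLp_velocity (γ : PathSpace r t) :
    MemLp γ.velocity r (volume.restrict (Icc (0 : ℝ) t)) := γ.isPath.2.2

theorem velocity_add (γ η : PathSpace r t) :
    (γ + η).velocity =ᵐ[volume.restrict (Icc (0 : ℝ) t)] γ.velocity + η.velocity :=
  ae_deriv_add γ.isPath.1 η.isPath.1

theorem velocity_smul (c : ℝ) (γ : PathSpace r t) : (c • γ).velocity = c • γ.velocity :=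
  deriv_smul_fun c (pathExtend γ.toFun)

/-- The derivative as an element of `L^r([0, t])`. -/
def toLp (r : ℝ≥0∞) (t : ℝ≥0) :
    PathSpace r t →ₗ[ℝ] Lp ℝ r (volume.restrict (Icc (0 : ℝ) t)) where
  toFun γ := MemLp.toLp γ.velocity γ.memLp_velocity
  map_add' γ η := by
    rw [← MemLp.toLp_add]
    exact (MemLp.toLp_eq_toLp_iff _ _).2 (velocity_add γ η)
  map_smul' c γ := by
    rw [RingHom.id_apply, ← MemLp.toLp_const_smul]
    exact (MemLp.toLp_eq_toLp_iff _ _).2 (by rw [velocity_smul])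

theorem eval_eq (γ : PathSpace r t) {s : ℝ} (hs : s ∈ Icc (0 : ℝ) t) :
    γ.eval s = - ∫ u in s..t, γ.velocity u := by
  have h := (γ.isPath.1.mono (c := s) (d := t) (by
    rw [uIcc_of_le hs.2, uIcc_of_le t.coe_nonneg]
    exact Icc_subset_Icc_left hs.1)).integral_deriv_eq_sub
  have h0 : pathExtend γ.toFun t = 0 := by
    rw [pathExtend, IccExtend_of_mem _ _ (right_mem_Icc.2 t.coe_nonneg)]
    exact γ.isPath.2.1
  simp only [velocity, eval, h, h0]
  ring

theorem toLp_injective : Function.Injective (toLp r t) := by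
  intro γ η h
  have h' := (MemLp.toLp_eq_toLp_iff γ.memLp_velocity η.memLp_velocity).1 h
  rw [Filter.EventuallyEq, ae_restrict_iff' measurableSet_Icc] at h'
  apply toFun_injective
  funext s
  have key : γ.eval s = η.eval s := by
    rw [eval_eq γ s.2, eval_eq η s.2]
    congr 1
    apply intervalIntegral.integral_congr_ae
    filter_upwards [h'] with u hu hu2
    rw [uIoc_of_le s.2.2] at hu2
    exact hu ⟨s.2.1.trans hu2.1.le, hu2.2⟩
  simpa [eval, pathExtend] using key

variable [Fact (1 ≤ r)]

/-- The norm of `B_r` is the `L^r` norm of the derivative. -/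
instance : NormedAddCommGroup (PathSpace r t) :=
  NormedAddCommGroup.induced _ _ (toLp r t) toLp_injective

instance : NormedSpace ℝ (PathSpace r t) := NormedSpace.induced ℝ _ _ (toLp r t)

instance : MeasurableSpace (PathSpace r t) := borel _

instance : BorelSpace (PathSpace r t) := ⟨rfl⟩

theorem norm_eq (h : r ≠ ∞) (γ : PathSpace r t) :
    ‖γ‖ = (∫ s in (0 : ℝ)..t, |γ.velocity s| ^ r.toReal) ^ r.toReal⁻¹ := by
  have h1 : r ≠ 0 := (zero_lt_one.trans_le (Fact.out : 1 ≤ r)).ne'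
  change ‖MemLp.toLp γ.velocity γ.memLp_velocity‖ = _
  rw [Lp.norm_toLp, MemLp.eLpNorm_eq_integral_rpow_norm h1 h γ.memLp_velocity, ENNReal.toReal_ofReal,
    intervalIntegral.integral_of_le t.coe_nonneg, integral_Icc_eq_integral_Ioc]
  · rfl
  · positivity

end PathSpace

instance fact_one_le_natCast (p : ℕ) [h : Fact (2 ≤ p)] : Fact (1 ≤ (p : ℝ≥0∞)) :=
  ⟨by exact_mod_cast (one_le_two.trans h.out)⟩

/-- The duality pairing `⟨η, γ⟩ = ∫₀ᵗ η'(s) γ'(s) ds` between `B_q` and `B_p`. -/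
def pathPairing {q p : ℝ≥0∞} {t : ℝ≥0} (η : PathSpace q t) (γ : PathSpace p t) : ℝ :=
  ∫ s in (0 : ℝ)..t, η.velocity s * γ.velocity s

/-- The phase function `Φ_p(γ) = (-1)^p α ∫₀ᵗ γ'(s)^p ds` on `B_p`. -/
def pathPhase (p : ℕ) (α : ℂ) {t : ℝ≥0} (γ : PathSpace (p : ℝ≥0∞) t) : ℂ :=
  (-1) ^ p * α * ((∫ s in (0 : ℝ)..t, γ.velocity s ^ p : ℝ) : ℂ)

/-- The infinite dimensional Fresnel integral on `B_q` with phase function `Φ_p`. -/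
def pathFresnel (p : ℕ) [Fact (2 ≤ p)] (q : ℝ≥0∞) (α : ℂ) (t : ℝ≥0)
    (f : PathSpace q t → ℂ) : ℂ :=
  fresnelIntegral (pathPairing (p := (p : ℝ≥0∞))) (pathPhase p α) f

/-- The functional `f_{t,x}(η) = u₀(x + η(0)) exp (∫₀ᵗ V(x + η(s)) ds)`. -/
def feynmanKacFunctional (q : ℝ≥0∞) (u₀ V : ℝ → ℂ) (t : ℝ≥0) (x : ℝ) (η : PathSpace q t) : ℂ :=
  u₀ (x + η.eval 0) * Complex.exp (∫ s in (0 : ℝ)..t, V (x + η.eval s))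

/-- The functional `η ↦ u₀(x + η(0)) V(x + η(s₁)) ⋯ V(x + η(sₙ))`. -/
def cylinderFunctional (q : ℝ≥0∞) (u₀ V : ℝ → ℂ) (t : ℝ≥0) (x : ℝ) {n : ℕ} (s : Fin n → ℝ)
    (η : PathSpace q t) : ℂ :=
  u₀ (x + η.eval 0) * ∏ i, V (x + η.eval (s i))

/-- The simplex `0 ≤ s₁ ≤ ⋯ ≤ sₙ ≤ t`. -/
def timeSimplex (n : ℕ) (t : ℝ≥0) : Set (Fin n → ℝ) :=
  {s | (∀ i, s i ∈ Icc (0 : ℝ) t) ∧ Monotone s}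

/-! ### Operators and semigroups on `L²(ℝ)` -/

/-- `L²(ℝ)`, complex valued. -/
abbrev L2R : Type := Lp ℂ 2 (volume : Measure ℝ)

/-- The maximal multiplication operator `u ↦ m u` on `L²(ℝ)`, with domain
`{u ∈ L² : m u ∈ L²}`. -/
def mulOp (m : ℝ → ℂ) : L2R →ₗ.[ℂ] L2R where
  domain :=
    { carrier := {u | MemLp (fun x => m x * u x) 2 volume}
      zero_mem' := by
        refine (memLp_congr_ae ?_).2 (MemLp.zero (ε := ℂ))
        filter_upwards [Lp.coeFn_zero ℂ 2 (volume : Measure ℝ)] with x hx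
        simp
      add_mem' := by
        intro u v hu hv
        refine (memLp_congr_ae ?_).2 (MemLp.add hu hv)
        filter_upwards [Lp.coeFn_add u v] with x hx
        simp only [hx, Pi.add_apply, mul_add]
      smul_mem' := by
        intro c u hu
        refine (memLp_congr_ae ?_).2 (MemLp.const_smul hu c)
        filter_upwards [Lp.coeFn_smul c u] with x hx
        simp [hx, mul_left_comm] }
  toFun :=
    { toFun := fun u => MemLp.toLp (fun x => m x * u.1 x) u.2
      map_add' := by
        intro u v
        rw [← MemLp.toLp_add]
        refine (MemLp.toLp_eq_toLp_iff _ _).2 ?_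
        filter_upwards [Lp.coeFn_add u.1 v.1] with x hx
        change m x * (u.1 + v.1 : L2R) x = m x * u.1 x + m x * v.1 x
        rw [hx, Pi.add_apply, mul_add]
      map_smul' := by
        intro c u
        rw [RingHom.id_apply, ← MemLp.toLp_const_smul]
        refine (MemLp.toLp_eq_toLp_iff _ _).2 ?_
        filter_upwards [Lp.coeFn_smul c u.1] with x hx
        simp [hx, mul_left_comm] }

/-- The Fourier multiplier operator `u ↦ 𝓕⁻¹ (m 𝓕 u)` on `L²(ℝ)`, with its maximal domain
`{u ∈ L² : m 𝓕 u ∈ L²}`. -/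
def fourierMulOp (m : ℝ → ℂ) : L2R →ₗ.[ℂ] L2R where
  domain := (mulOp m).domain.comap (Lp.fourierTransformₗᵢ ℝ ℂ).toLinearEquiv.toLinearMap
  toFun := (Lp.fourierTransformₗᵢ ℝ ℂ).symm.toLinearEquiv.toLinearMap ∘ₗ (mulOp m).toFun ∘ₗ
    (Lp.fourierTransformₗᵢ ℝ ℂ).toLinearEquiv.toLinearMap.restrict (fun _ h => h)

/-- The operator `A = (-i)^p α ∂_x^p`, that is, multiplication of the Fourier transform by `α k^p`;
since `𝓕` has the kernel `exp (-2πi x ξ)`, the frequency is `k = 2πξ`. For `α ≠ 0` the domain is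
`H^p = {u ∈ L² : k^p û ∈ L²}`; for `α = 0` this is the zero operator on all of `L²`. -/
def freeOp (p : ℕ) (α : ℂ) : L2R →ₗ.[ℂ] L2R :=
  fourierMulOp fun ξ => α * ((2 * Real.pi * ξ : ℝ) : ℂ) ^ p

/-- Strongly continuous one-parameter semigroup `(T t)_{t ≥ 0}` (the values at `t < 0` are
irrelevant). -/
structure IsC0Semigroup {H : Type*} [NormedAddCommGroup H] [NormedSpace ℂ H]
    (T : ℝ → H →L[ℂ] H) : Prop where
  map_zero : T 0 = 1
  map_add : ∀ s t, 0 ≤ s → 0 ≤ t → T (s + t) = T s ∘L T t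
  continuousOn : ∀ u, ContinuousOn (fun t => T t u) (Ici 0)

/-- `A`, with exactly its domain, is the infinitesimal generator of `T`. -/
def IsGenerator {H : Type*} [NormedAddCommGroup H] [NormedSpace ℂ H] (A : H →ₗ.[ℂ] H)
    (T : ℝ → H →L[ℂ] H) : Prop :=
  ∀ u v : H, (u, v) ∈ A.graph ↔
    Tendsto (fun h : ℝ => ((h : ℂ)⁻¹) • (T h u - u)) (𝓝[>] 0) (𝓝 v)

open Classical in
/-- The product `V u` in `L²(ℝ)` (used for bounded `V`; it is `0` if `V u` is not in `L²`). -/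
def mulL2 (V : ℝ → ℂ) (u : L2R) : L2R :=
  if h : u ∈ (mulOp V).domain then mulOp V ⟨u, h⟩ else 0

/-- The terms `S₀(t) u = E t u`, `Sₙ₊₁(t) u = ∫₀ᵗ E (t - s) V Sₙ(s) u ds` of the Dyson series. -/
def dysonTerm (E : ℝ → L2R →L[ℂ] L2R) (V : ℝ → ℂ) : ℕ → ℝ → L2R → L2R
  | 0, t, u => E t u
  | n + 1, t, u => ∫ s in (0 : ℝ)..t, E (t - s) (mulL2 V (dysonTerm E V n s u))

end

noncomputable section

/-! ### Complex measures and densities -/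

section ComplexMeasure

variable {E : Type*} [MeasurableSpace E]

/-! Write `u₀` and `V` as superpositions of plane waves with complex densities `c₀ dm₀` and `c dm`.
The `n`-th term of `exp (∫ V)` is the integral of `V(x + η(s₁)) ⋯ V(x + η(sₙ))` over the ordered
simplex (`setIntegral_timeSimplex_prod`). Evaluation at `s` is pairing with a ramp, so each such
product is a superposition, over frequencies `y₀, …, yₙ`, of `exp (i ⟨η, γ⟩)` with `γ = rampSum`, a
path of piecewise constant velocity. Hence the functional is the Fourier transform of a sum of image
measures whose masses are bounded by the terms of an exponential series
(`feynmanKacFunctional_fresnel`).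

The Fresnel integral replaces `exp (i ⟨η, γ⟩)` by `exp (Φ(γ))`. Between `sₖ` and `sₖ₊₁` the velocity
of `γ` is `-(y₀ + ⋯ + yₖ)`, and the sign cancels `(-1)^p`, so `exp (Φ(γ))` is the product of the
factors `exp ((sₖ₊₁ - sₖ) α (y₀ + ⋯ + yₖ)^p)`. The Dyson series gives the same product: the free
semigroup multiplies a plane wave by the exponential of its symbol, and multiplication by `V` adds a
frequency. `pathPhase_rampSum_snoc` splits off the last time, and `boundedDyson_ae_eq` turns this
into an induction on `n`.

Three analytic points remain. The choice of representing measure is immaterial because a complex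
measure on the separable space `B_p` is determined by its Fourier transform
(`measureFourier_injective`). Single plane waves are not in `L²`, so the action of the free
semigroup on superpositions is checked against test functions (`freeSemigroup_planeWaves`). The
perturbed semigroup is built as the norm convergent Dyson series, and its `L²` sum agrees almost
everywhere with the pointwise sum (`ae_eq_of_hasSum_L2`). The hypothesis on `α` enters as `Re (α
x^p) ≤ 0`, which makes the free semigroup contractive and gives `|exp Φ| ≤ 1`. -/

theorem MeasureTheory.SignedMeasure.absolutelyContinuous_of_totalVariation_le
    (s : SignedMeasure E) {m : Measure E} (h : s.totalVariation ≤ m) :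
    s ≪ᵥ m.toENNRealVectorMeasure := by
  refine VectorMeasure.AbsolutelyContinuous.mk fun i hi h0 => ?_
  rw [Measure.toENNRealVectorMeasure_apply_measurable hi] at h0
  have h1 := (s.enorm_le_totalVariation i).trans ((h i).trans_eq h0)
  simpa using h1

/-- Every complex measure has an integrable density with respect to a finite measure. -/
theorem MeasureTheory.ComplexMeasure.exists_withDensity (μ : ComplexMeasure E) :
    ∃ (m : Measure E) (c : E → ℂ), IsFiniteMeasure m ∧ Measurable c ∧ Integrable c m ∧
      μ = m.withDensityᵥ c := by
  set s₁ := ComplexMeasure.re μ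
  set s₂ := ComplexMeasure.im μ
  -- This finite measure dominates both the real and the imaginary part, so Radon–Nikodym applies to
  -- each of them.
  set m := s₁.totalVariation + s₂.totalVariation with hm
  have h₁ := SignedMeasure.withDensityᵥ_rnDeriv_eq s₁ m
    (s₁.absolutelyContinuous_of_totalVariation_le (Measure.le_add_right le_rfl))
  have h₂ := SignedMeasure.withDensityᵥ_rnDeriv_eq s₂ m
    (s₂.absolutelyContinuous_of_totalVariation_le (Measure.le_add_left le_rfl))
  have i₁ := SignedMeasure.integrable_rnDeriv s₁ m
  have i₂ := SignedMeasure.integrable_rnDeriv s₂ m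
  have hc : Integrable (fun x => ((s₁.rnDeriv m x : ℝ) : ℂ) + (s₂.rnDeriv m x : ℝ) * Complex.I) m :=
    i₁.ofReal.add (i₂.ofReal.mul_const _)
  refine ⟨m, _, inferInstance, ?_, hc, ?_⟩
  · exact (Complex.measurable_ofReal.comp (SignedMeasure.measurable_rnDeriv _ _)).add
      ((Complex.measurable_ofReal.comp (SignedMeasure.measurable_rnDeriv _ _)).mul_const _)
  · ext s hs
    rw [withDensityᵥ_apply hc hs, integral_add i₁.ofReal.restrict
      (i₂.ofReal.mul_const _).restrict, integral_mul_const, integral_complex_ofReal, integral_complex_ofReal,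
      ← withDensityᵥ_apply i₁ hs, ← withDensityᵥ_apply i₂ hs, h₁, h₂]
    have hre : s₁ s = (μ s).re := rfl
    have him : s₂ s = (μ s).im := rfl
    apply Complex.ext <;> simp [hre, him]

theorem isFiniteMeasure_variation_withDensityᵥ {m : Measure E} {c : E → ℂ} (hc : Integrable c m) :
    IsFiniteMeasure (m.withDensityᵥ c).variation := by
  rw [Measure.variation_withDensityᵥ hc]
  exact isFiniteMeasure_withDensity hc.hasFiniteIntegral.ne

/-- Both sides are additive in `f` and pass to bounded pointwise limits, so it suffices to check
indicators of measurable sets, where the formula is the definition of the density. -/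
theorem cIntegral_withDensityᵥ {m : Measure E} {c f : E → ℂ} (hc : Integrable c m)
    (hf : Measurable f) {C : ℝ} (hC : ∀ x, ‖f x‖ ≤ C) :
    cIntegral (m.withDensityᵥ c) f = ∫ x, f x * c x ∂m := by
  have := isFiniteMeasure_variation_withDensityᵥ hc
  have key : ∀ g : SimpleFunc E ℂ, cIntegral (m.withDensityᵥ c) g = ∫ x, g x * c x ∂m := by
    intro g
    have hint : ∀ g : SimpleFunc E ℂ, Integrable (fun x => g x * c x) m := fun g => by
      obtain ⟨C, hC⟩ := g.exists_forall_norm_le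
      exact hc.bdd_mul g.measurable.aestronglyMeasurable (ae_of_all _ hC)
    induction g using SimpleFunc.induction with
    | const a hs =>
      rename_i s
      have e : ⇑(SimpleFunc.piecewise s hs (SimpleFunc.const E a) (SimpleFunc.const E 0)) =
          s.indicator fun _ => a := by
        funext x
        by_cases hx : x ∈ s <;> simp [hx]
      rw [e, cIntegral, VectorMeasure.integral_eq_setToFun,
        setToFun_indicator_const _ hs (measure_ne_top _ _)]
      change a * (m.withDensityᵥ c) s = _
      rw [withDensityᵥ_apply hc hs, ← integral_const_mul, ← integral_indicator hs]
      congr 1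
      funext x
      by_cases hx : x ∈ s <;> simp [hx]
    | add _ h₁ h₂ =>
      rename_i f g _
      rw [SimpleFunc.coe_add, cIntegral, VectorMeasure.integral_add f.integrable_of_isFiniteMeasure
        g.integrable_of_isFiniteMeasure]
      simp only [cIntegral] at h₁ h₂
      rw [h₁, h₂, ← integral_add (hint f) (hint g)]
      simp [add_mul]
  have hf' : StronglyMeasurable f := hf.stronglyMeasurable
  have h1 : Tendsto (fun n => cIntegral (m.withDensityᵥ c) (hf'.approxBounded C n)) atTop
      (𝓝 (cIntegral (m.withDensityᵥ c) f)) := by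
    have hC0 : ∀ x, 0 ≤ C := fun x => (norm_nonneg _).trans (hC x)
    refine VectorMeasure.tendsto_integral_of_dominated_convergence (fun _ => |C|)
      (fun n => (SimpleFunc.measurable _).aestronglyMeasurable) (integrable_const _)
      (fun n => ae_of_all _ fun x => ?_) (ae_of_all _ fun x => ?_)
    · exact (hf'.norm_approxBounded_le (hC0 x) n x).trans (le_abs_self _)
    · exact hf'.tendsto_approxBounded_of_norm_le (hC x)
  have h2 : Tendsto (fun n => ∫ x, hf'.approxBounded C n x * c x ∂m) atTop
      (𝓝 (∫ x, f x * c x ∂m)) := by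
    have hC0 : ∀ x, 0 ≤ C := fun x => (norm_nonneg _).trans (hC x)
    refine tendsto_integral_of_dominated_convergence (fun x => C * ‖c x‖)
      (fun n => (SimpleFunc.measurable _).aestronglyMeasurable.mul hc.1) (hc.norm.const_mul _)
      (fun n => ae_of_all _ fun x => ?_) (ae_of_all _ fun x => ?_)
    · rw [norm_mul]
      exact mul_le_mul_of_nonneg_right (hf'.norm_approxBounded_le (hC0 x) n x) (norm_nonneg _)
    · exact (hf'.tendsto_approxBounded_of_norm_le (hC x)).mul_const _
  simp only [key] at h1
  exact tendsto_nhds_unique h1 h2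

/-- Superposition of countably many weighted image measures into one complex measure. -/
theorem exists_complexMeasure_hasSum {Ω : ℕ → Type*} [∀ n, MeasurableSpace (Ω n)]
    (M : ∀ n, Measure (Ω n)) (Y : ∀ n, Ω n → E) (c : ∀ n, Ω n → ℂ) (hY : ∀ n, Measurable (Y n))
    (hc : ∀ n, Measurable (c n)) (hi : ∀ n, Integrable (c n) (M n))
    (hs : Summable fun n => ∫ ω, ‖c n ω‖ ∂M n) :
    ∃ μ : ComplexMeasure E, ∀ F : E → ℂ, Measurable F → (∃ C, ∀ x, ‖F x‖ ≤ C) →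
      HasSum (fun n => ∫ ω, F (Y n ω) * c n ω ∂M n) (cIntegral μ F) := by
  -- Each weight is transported together with its point. On the sum of the image measures in `E × ℂ`
  -- the second coordinate is then a common density for all `n`, and projecting to `E` gives the
  -- required complex measure.
  set N : Measure (E × ℂ) := Measure.sum fun n => (M n).map fun ω => (Y n ω, c n ω) with hN
  have hYc : ∀ n, Measurable fun ω => (Y n ω, c n ω) := fun n => (hY n).prodMk (hc n)
  have hsnd : Integrable (Prod.snd : E × ℂ → ℂ) N := by
    refine ⟨measurable_snd.aestronglyMeasurable, ?_⟩
    rw [HasFiniteIntegral, hN, lintegral_sum_measure]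
    have e : ∀ n, ∫⁻ a : E × ℂ, ‖a.2‖ₑ ∂(M n).map (fun ω => (Y n ω, c n ω)) =
        ENNReal.ofReal (∫ ω, ‖c n ω‖ ∂M n) := by
      intro n
      rw [lintegral_map (by fun_prop) (hYc n), ofReal_integral_norm_eq_lintegral_enorm (hi n)]
    simp only [e]
    rw [← ENNReal.ofReal_tsum_of_nonneg (fun n => integral_nonneg fun _ => norm_nonneg _) hs]
    exact ENNReal.ofReal_lt_top
  have := isFiniteMeasure_variation_withDensityᵥ hsnd
  refine ⟨(N.withDensityᵥ Prod.snd).map Prod.fst, fun F hF ⟨C, hC⟩ => ?_⟩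
  have hF1 : Measurable fun x : E × ℂ => F x.1 := hF.comp measurable_fst
  have hFi : Integrable (F ∘ Prod.fst) (N.withDensityᵥ (Prod.snd : E × ℂ → ℂ)).variation :=
    Integrable.of_bound hF1.aestronglyMeasurable C
      (ae_of_all _ fun x => hC x.1)
  rw [cIntegral, VectorMeasure.integral_map measurable_fst hF.aestronglyMeasurable hFi]
  have e := cIntegral_withDensityᵥ hsnd (f := fun x => F x.1) hF1
    (fun x => hC x.1)
  rw [cIntegral] at e
  rw [e]
  have hint : Integrable (fun x : E × ℂ => F x.1 * x.2) N :=
    hsnd.bdd_mul hF1.aestronglyMeasurable (ae_of_all _ fun x => hC x.1)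
  have hm : Measurable fun x : E × ℂ => F x.1 * x.2 := hF1.mul measurable_snd
  have hmap : ∀ n, ∫ x : E × ℂ, F x.1 * x.2 ∂(M n).map (fun ω => (Y n ω, c n ω)) =
      ∫ ω, F (Y n ω) * c n ω ∂M n := fun n =>
    integral_map (hYc n).aemeasurable hm.aestronglyMeasurable
  simpa only [hmap] using hasSum_integral_measure hint

theorem withDensityᵥ_eq_zero_of_re_im {m : Measure E} {c : E → ℂ}
    (h₁ : ∀ᵐ x ∂m, (c x).re = 0) (h₂ : ∀ᵐ x ∂m, (c x).im = 0) : m.withDensityᵥ c = 0 := by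
  have h : c =ᵐ[m] 0 := by
    filter_upwards [h₁, h₂] with x a b
    exact Complex.ext a b
  rw [WithDensityᵥEq.congr_ae h, withDensityᵥ_zero]

/-! ### Uniqueness of the representing complex measure -/

section Uniqueness

variable {V W : Type*} [NormedAddCommGroup V] [NormedSpace ℝ V] [MeasurableSpace V]
  [BorelSpace V] [CompleteSpace V] [SecondCountableTopology V]
  [AddCommGroup W] [Module ℝ W] [TopologicalSpace W] {L : V →ₗ[ℝ] W →ₗ[ℝ] ℝ}

/-- The positive and negative parts of `g` are densities of two finite measures with the same
characteristic function. Such measures coincide, so the two parts agree almost everywhere. -/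
theorem ae_eq_zero_of_integral_exp_eq_zero (hL' : ∀ v ≠ 0, L v ≠ 0)
    (hL : Continuous fun p : V × W => L p.1 p.2) {m : Measure V} [IsFiniteMeasure m]
    {g : V → ℝ} (hg : Integrable g m)
    (h : ∀ w, ∫ v, Complex.exp (Complex.I * (L v w : ℝ)) * (g v : ℂ) ∂m = 0) : g =ᵐ[m] 0 := by
  have hpos := isFiniteMeasure_withDensity_ofReal (f := g) hg.2
  have hg' : Integrable (fun x => - g x) m := hg.neg
  have hneg := isFiniteMeasure_withDensity_ofReal (f := fun x => - g x) hg.neg.2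
  have hce : ∀ w, Continuous fun v => Complex.exp (Complex.I * (L v w : ℝ)) := fun w => by
    have : Continuous fun v => L v w := hL.comp (by fun_prop : Continuous fun v => (v, w))
    fun_prop
  have hnorm : ∀ w v, ‖Complex.exp (Complex.I * (L v w : ℝ))‖ ≤ 1 := fun w v => by
    rw [mul_comm, Complex.norm_exp_ofReal_mul_I]
  have hdens : ∀ (k : V → ℝ) (hk : Integrable k m) w,
      ∫ v, Complex.exp (Complex.I * (L v w : ℝ)) ∂(m.withDensity fun x => ENNReal.ofReal (k x)) =
      ∫ v, Complex.exp (Complex.I * (L v w : ℝ)) * ((max (k v) 0 : ℝ) : ℂ) ∂m := fun k hk w => by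
    rw [integral_withDensity_eq_integral_toReal_smul₀ hk.1.aemeasurable.ennreal_ofReal
      (ae_of_all _ fun x => ENNReal.ofReal_lt_top)]
    congr 1
    funext v
    rw [Complex.real_smul, mul_comm, ENNReal.toReal_ofReal']
  have hint : ∀ (k : V → ℝ) (hk : Integrable k m) w,
      Integrable (fun v => Complex.exp (Complex.I * (L v w : ℝ)) * ((max (k v) 0 : ℝ) : ℂ)) m :=
    fun k hk w => hk.pos_part.ofReal.bdd_mul (hce w).aestronglyMeasurable (ae_of_all _ (hnorm w))
  have key : m.withDensity (fun x => ENNReal.ofReal (g x)) =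
      m.withDensity (fun x => ENNReal.ofReal (- g x)) := by
    refine ext_of_integral_char_eq (e := Real.probChar) Real.continuous_probChar
      Real.probChar_ne_one hL' hL fun w => ?_
    have hchar : ∀ v, BoundedContinuousFunction.char Real.continuous_probChar hL w v =
        Complex.exp (Complex.I * (L v w : ℝ)) := fun v => by
      rw [BoundedContinuousFunction.char_apply, Real.probChar_apply, mul_comm]
    simp only [hchar]
    rw [hdens g hg, hdens _ hg', ← sub_eq_zero, ← integral_sub (hint _ hg w) (hint _ hg' w),
      ← h w]
    congr 1
    funext v
    rw [← mul_sub, ← Complex.ofReal_sub]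
    congr 2
    exact max_zero_sub_max_neg_zero_eq_self (g v)
  have h2 := (withDensity_eq_iff hg.1.aemeasurable.ennreal_ofReal
    hg'.1.aemeasurable.ennreal_ofReal (by
      simpa using hpos.measure_univ_lt_top.ne)).1 key
  filter_upwards [h2] with x hx
  rcases le_total 0 (g x) with h0 | h0
  · rw [ENNReal.ofReal_of_nonpos (neg_nonpos.2 h0), ENNReal.ofReal_eq_zero] at hx
    exact le_antisymm hx h0
  · rw [ENNReal.ofReal_of_nonpos h0, eq_comm, ENNReal.ofReal_eq_zero] at hx
    exact le_antisymm h0 (neg_nonpos.1 hx)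

/-- A complex measure on a separable Banach space is determined by its Fourier transform, as soon
as the pairing separates points. -/
theorem measureFourier_injective (hL' : ∀ v ≠ 0, L v ≠ 0)
    (hL : Continuous fun p : V × W => L p.1 p.2) :
    Function.Injective (measureFourier (fun (w : W) (v : V) => L v w)) := by
  intro μ ν hμν
  obtain ⟨m, c, hm, -, hc, hd⟩ := (μ - ν).exists_withDensity
  have hce : ∀ w, Continuous fun v => Complex.exp (Complex.I * (L v w : ℝ)) := fun w => by
    have : Continuous fun v => L v w := hL.comp (by fun_prop : Continuous fun v => (v, w))
    fun_prop
  have hnorm : ∀ w v, ‖Complex.exp (Complex.I * (L v w : ℝ))‖ ≤ 1 := fun w v => by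
    rw [mul_comm, Complex.norm_exp_ofReal_mul_I]
  have hvar : ∀ ρ : ComplexMeasure V, IsFiniteMeasure ρ.variation := fun ρ => by
    obtain ⟨m', c', -, -, hc', rfl⟩ := ρ.exists_withDensity
    exact isFiniteMeasure_variation_withDensityᵥ hc'
  have hzero : ∀ w, ∫ v, Complex.exp (Complex.I * (L v w : ℝ)) * c v ∂m = 0 := fun w => by
    have i : ∀ ρ : ComplexMeasure V,
        ρ.Integrable fun v => Complex.exp (Complex.I * (L v w : ℝ)) := fun ρ => by
      have := hvar ρ
      exact Integrable.of_bound (hce w).aestronglyMeasurable 1 (ae_of_all _ (hnorm w))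
    rw [← cIntegral_withDensityᵥ hc (hce w).measurable (hnorm w), ← hd, cIntegral,
      VectorMeasure.integral_sub_vectorMeasure (i μ) (i ν), sub_eq_zero]
    exact congrFun hμν w
  -- Conjugation together with `w ↦ -w` shows that the conjugate density also has zero transform.
  -- The real and imaginary parts of `c` can therefore be treated separately by the real case.
  have hconj : ∀ w, ∫ v, Complex.exp (Complex.I * (L v w : ℝ)) * (starRingEnd ℂ) (c v) ∂m = 0 :=
    fun w => by
    have h1 := hzero (-w)
    rw [← map_eq_zero (starRingEnd ℂ), ← integral_conj] at h1
    rw [← h1]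
    congr 1
    funext v
    rw [map_mul, ← Complex.exp_conj]
    simp
  have hi1 : ∀ w, Integrable (fun v => Complex.exp (Complex.I * (L v w : ℝ)) * c v) m :=
    fun w => hc.bdd_mul (hce w).aestronglyMeasurable (ae_of_all _ (hnorm w))
  have hi2 : ∀ w, Integrable
      (fun v => Complex.exp (Complex.I * (L v w : ℝ)) * (starRingEnd ℂ) (c v)) m := fun w =>
    (Complex.conjCLE.toContinuousLinearMap.integrable_comp hc).bdd_mul
      (hce w).aestronglyMeasurable (ae_of_all _ (hnorm w))
  have h1 := ae_eq_zero_of_integral_exp_eq_zero hL' hL (g := fun v => (c v).re) hc.re fun w => by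
    have : ∀ v, Complex.exp (Complex.I * (L v w : ℝ)) * ((c v).re : ℂ) = (2 : ℂ)⁻¹ *
        (Complex.exp (Complex.I * (L v w : ℝ)) * c v +
          Complex.exp (Complex.I * (L v w : ℝ)) * (starRingEnd ℂ) (c v)) := fun v => by
      rw [Complex.re_eq_add_conj]
      ring
    simp only [this]
    rw [integral_const_mul, integral_add (hi1 w) (hi2 w), hzero, hconj]
    simp
  have h2 := ae_eq_zero_of_integral_exp_eq_zero hL' hL (g := fun v => (c v).im) hc.im fun w => by
    have : ∀ v, Complex.exp (Complex.I * (L v w : ℝ)) * ((c v).im : ℂ) = (2 * Complex.I)⁻¹ *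
        (Complex.exp (Complex.I * (L v w : ℝ)) * c v -
          Complex.exp (Complex.I * (L v w : ℝ)) * (starRingEnd ℂ) (c v)) := fun v => by
      rw [Complex.im_eq_sub_conj]
      ring
    simp only [this]
    rw [integral_const_mul, integral_sub (hi1 w) (hi2 w), hzero, hconj]
    simp
  rw [← sub_eq_zero, hd]
  exact withDensityᵥ_eq_zero_of_re_im h1 h2

end Uniqueness

end ComplexMeasure

/-! ### The path spaces as `L^r` spaces -/

namespace PathSpace

variable {r : ℝ≥0∞} {t : ℝ≥0}

/-- Lebesgue measure on `[0, t]`. -/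
abbrev timeMeasure (t : ℝ≥0) : Measure ℝ := volume.restrict (Icc (0 : ℝ) t)

section ofVelocity

variable [Fact (1 ≤ r)] (v : ℝ → ℝ)

theorem integrable_indicator_of_memLp (hv : MemLp v r (timeMeasure t)) :
    Integrable ((Ioc (0 : ℝ) t).indicator v) := by
  rw [integrable_indicator_iff measurableSet_Ioc]
  exact (hv.integrable Fact.out).mono_measure (Measure.restrict_mono Ioc_subset_Icc_self le_rfl)

/-- The truncated velocity vanishes outside `(0, t]`, so its primitive on the whole line is already
constant on both sides of the interval. -/
theorem pathExtend_primitive (hi : Integrable ((Ioc (0 : ℝ) t).indicator v)) :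
    pathExtend (fun s : Icc (0 : ℝ) t => ∫ u in (t : ℝ)..s, (Ioc (0 : ℝ) t).indicator v u) =
      fun x => ∫ u in (t : ℝ)..x, (Ioc (0 : ℝ) t).indicator v u := by
  funext x
  rw [pathExtend, IccExtend_apply]
  have hzero : ∀ a b : ℝ, (∀ u ∈ uIoc a b, u ∉ Ioc (0 : ℝ) t) →
      ∫ u in a..b, (Ioc (0 : ℝ) t).indicator v u = 0 := fun a b h => by
    rw [intervalIntegral.integral_zero_ae]
    exact ae_of_all _ fun u hu => indicator_of_notMem (h u hu) _
  dsimp only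
  rw [← sub_eq_zero, intervalIntegral.integral_interval_sub_left hi.intervalIntegrable
    hi.intervalIntegrable]
  apply hzero
  intro u hu hu'
  rw [uIoc, mem_Ioc] at hu
  rcases le_total x 0 with h | h
  · rw [max_eq_left ((min_le_right _ _).trans h)] at hu
    rw [max_eq_right h] at hu
    exact absurd hu.2 (not_le.2 hu'.1)
  · rcases le_total x t with h2 | h2
    · rw [min_eq_right h2, max_eq_right h] at hu
      simp only [min_self, max_self] at hu
      exact absurd hu.1 (not_lt.2 hu.2)
    · rw [min_eq_left h2, max_eq_right t.coe_nonneg, min_eq_right h2] at hu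
      exact absurd hu.1 (not_lt.2 hu'.2)

theorem ae_deriv_primitive (hi : Integrable ((Ioc (0 : ℝ) t).indicator v)) :
    deriv (fun x => ∫ u in (t : ℝ)..x, (Ioc (0 : ℝ) t).indicator v u) =ᵐ[timeMeasure t] v := by
  rw [Filter.EventuallyEq, timeMeasure, ← Measure.restrict_congr_set Ioc_ae_eq_Icc,
    ae_restrict_iff' measurableSet_Ioc]
  filter_upwards [LocallyIntegrable.ae_hasDerivAt_integral hi.locallyIntegrable] with x hx hm
  rw [(hx t).deriv, indicator_of_mem hm]

/-- The path with prescribed velocity. -/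
def ofVelocity (hv : MemLp v r (timeMeasure t)) : PathSpace r t :=
  ⟨fun s : Icc (0 : ℝ) t => ∫ u in (t : ℝ)..s, (Ioc (0 : ℝ) t).indicator v u, by
    have hi := integrable_indicator_of_memLp v hv
    refine ⟨?_, intervalIntegral.integral_same, ?_⟩
    · rw [pathExtend_primitive v hi]
      exact (hi.intervalIntegrable (a := 0) (b := t)).absolutelyContinuousOnInterval_intervalIntegral
        right_mem_uIcc
    · rw [pathExtend_primitive v hi, memLp_congr_ae (ae_deriv_primitive v hi)]
      exact hv⟩

theorem velocity_ofVelocity (hv : MemLp v r (timeMeasure t)) :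
    (ofVelocity v hv).velocity =ᵐ[timeMeasure t] v := by
  have hi := integrable_indicator_of_memLp v hv
  have h := ae_deriv_primitive v hi
  rw [← pathExtend_primitive v hi] at h
  exact h

end ofVelocity

variable [Fact (1 ≤ r)]

/-- A path is the same as its velocity in `L^r([0, t])`. -/
def toLpEquiv (r : ℝ≥0∞) (t : ℝ≥0) [Fact (1 ≤ r)] :
    PathSpace r t ≃ₗᵢ[ℝ] Lp ℝ r (timeMeasure t) :=
  { LinearEquiv.ofBijective (toLp r t) ⟨toLp_injective, fun v => by
      refine ⟨ofVelocity v (Lp.memLp v), ?_⟩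
      refine Lp.ext ?_
      exact (MemLp.coeFn_toLp (memLp_velocity _)).trans (velocity_ofVelocity _ _)⟩ with
    norm_map' := fun _ => rfl }

theorem coeFn_toLpEquiv (γ : PathSpace r t) : toLpEquiv r t γ =ᵐ[timeMeasure t] γ.velocity :=
  MemLp.coeFn_toLp γ.memLp_velocity

instance : CompleteSpace (PathSpace r t) :=
  (toLpEquiv r t).symm.toIsometryEquiv.completeSpace_iff.1 inferInstance

/-- Separability of `L^r` for finite `r`; this is what makes the uniqueness theorem available on
`B_p`. -/
instance [Fact (r ≠ ∞)] : SecondCountableTopology (PathSpace r t) :=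
  (toLpEquiv r t).toHomeomorph.secondCountableTopology

theorem integral_velocity_comp (γ : PathSpace r t) (f : ℝ → ℝ → ℝ) :
    ∫ s in (0 : ℝ)..t, f s (γ.velocity s) = ∫ s, f s (toLpEquiv r t γ s) ∂timeMeasure t := by
  rw [intervalIntegral.integral_of_le t.coe_nonneg, ← integral_Icc_eq_integral_Ioc]
  refine integral_congr_ae ?_
  filter_upwards [coeFn_toLpEquiv γ] with s hs
  rw [hs]

end PathSpace

/-! ### Duality of the path spaces -/

section Pairing

variable {p q : ℝ≥0∞} {t : ℝ≥0} [Fact (1 ≤ p)] [Fact (1 ≤ q)] [ENNReal.HolderConjugate p q]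

/-- The duality pairing of path spaces as a bilinear map. -/
def pathPairingL (p q : ℝ≥0∞) (t : ℝ≥0) [Fact (1 ≤ p)] [Fact (1 ≤ q)]
    [ENNReal.HolderConjugate p q] : PathSpace p t →L[ℝ] PathSpace q t →L[ℝ] ℝ :=
  ((ContinuousLinearMap.mul ℝ ℝ).lpPairing (PathSpace.timeMeasure t) p q).bilinearComp
    (PathSpace.toLpEquiv p t).toLinearIsometry.toContinuousLinearMap
    (PathSpace.toLpEquiv q t).toLinearIsometry.toContinuousLinearMap

theorem pathPairingL_apply (γ : PathSpace p t) (η : PathSpace q t) :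
    pathPairingL p q t γ η = pathPairing η γ := by
  change (ContinuousLinearMap.mul ℝ ℝ).lpPairing (PathSpace.timeMeasure t) p q
    (PathSpace.toLpEquiv p t γ) (PathSpace.toLpEquiv q t η) = _
  rw [ContinuousLinearMap.lpPairing_eq_integral, pathPairing,
    intervalIntegral.integral_of_le t.coe_nonneg, ← integral_Icc_eq_integral_Ioc]
  refine integral_congr_ae ?_
  filter_upwards [PathSpace.coeFn_toLpEquiv γ, PathSpace.coeFn_toLpEquiv η] with s h1 h2
  rw [h1, h2, ContinuousLinearMap.mul_apply', mul_comm]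

/-- Pair `γ` with the path whose velocity is the sign of `γ'`. This velocity is bounded, hence in
`L^q` of a bounded interval, and the pairing is the `L¹` norm of `γ'`. -/
theorem pathPairingL_ne_zero (γ : PathSpace p t) (hγ : γ ≠ 0) : pathPairingL p q t γ ≠ 0 := by
  intro h
  apply hγ
  have hs : MemLp (fun s => SignType.sign (γ.velocity s) : ℝ → ℝ) q (PathSpace.timeMeasure t) := by
    refine MemLp.of_bound ?_ 1 (ae_of_all _ fun s => ?_)
    · have hm : Measurable fun x : ℝ => ((SignType.sign x : SignType) : ℝ) := by
        have e : (fun x : ℝ => ((SignType.sign x : SignType) : ℝ)) =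
            fun x => if 0 < x then 1 else if x < 0 then -1 else 0 := by
          funext x
          rw [sign_apply]
          split_ifs <;> simp
        rw [e]
        exact Measurable.ite measurableSet_Ioi measurable_const
          (Measurable.ite measurableSet_Iio measurable_const measurable_const)
      exact (hm.comp_aemeasurable γ.memLp_velocity.1.aemeasurable).aestronglyMeasurable
    · rcases lt_trichotomy (γ.velocity s) 0 with h | h | h <;> simp [h]
  have h1 : pathPairing (PathSpace.ofVelocity _ hs) γ = 0 := by
    rw [← pathPairingL_apply, h]
    rfl
  rw [pathPairing, intervalIntegral.integral_of_le t.coe_nonneg,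
    ← integral_Icc_eq_integral_Ioc] at h1
  have h2 : ∫ s, |γ.velocity s| ∂PathSpace.timeMeasure t = 0 := by
    rw [← h1]
    refine integral_congr_ae ?_
    filter_upwards [PathSpace.velocity_ofVelocity _ hs] with s hs
    rw [hs, sign_mul_self]
  rw [integral_eq_zero_iff_of_nonneg (fun _ => abs_nonneg _)
    (γ.memLp_velocity.integrable Fact.out).abs] at h2
  apply PathSpace.toLp_injective
  rw [map_zero]
  refine Lp.ext ?_
  filter_upwards [h2, PathSpace.coeFn_toLpEquiv γ, Lp.coeFn_zero ℝ p (PathSpace.timeMeasure t)]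
    with s a b c
  rw [c]
  exact b.trans (abs_eq_zero.1 a)

theorem pathMeasureFourier_injective [Fact (p ≠ ∞)] :
    Function.Injective (measureFourier (pathPairing (q := q) (p := p) (t := t))) := by
  have h := measureFourier_injective (V := PathSpace p t) (W := PathSpace q t)
    (L := (pathPairingL p q t).toLinearMap₁₂) 
    (fun γ hγ h0 => pathPairingL_ne_zero (q := q) γ hγ (by
      ext η
      exact congrArg (fun f => f η) h0))
    (by
      exact (pathPairingL p q t).continuous₂)
  convert h using 4
  exact (pathPairingL_apply _ _).symm

/-- The definition selects some representing measure by choice; injectivity forces the selected one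
to be `μ`. -/
theorem fresnelIntegral_measureFourier_of_injective {X E : Type*} [MeasurableSpace E]
    {pair : X → E → ℝ} (h : Function.Injective (measureFourier pair)) (Φ : E → ℂ)
    (μ : ComplexMeasure E) :
    fresnelIntegral pair Φ (measureFourier pair μ) = cIntegral μ fun y => Complex.exp (Φ y) := by
  have hm : measureFourier pair μ ∈ FourierClass pair := mem_range_self μ
  rw [fresnelIntegral, dif_pos hm, h hm.choose_spec]

end Pairing

/-! ### The phase function -/

section Phase

variable {t : ℝ≥0} (p : ℕ)

/-- Pointwise, `x^p` is the `p`-th power of the positive part plus `(-1)^p` times that of the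
negative part. Continuity of the phase then follows from continuity of the lattice operations and of
the norm in `L^p`. -/
theorem integral_velocity_pow_eq [Fact (2 ≤ p)] (γ : PathSpace (p : ℝ≥0∞) t) :
    ∫ s in (0 : ℝ)..t, γ.velocity s ^ p =
      ‖Lp.posPart (PathSpace.toLpEquiv p t γ)‖ ^ p +
        (-1) ^ p * ‖Lp.negPart (PathSpace.toLpEquiv p t γ)‖ ^ p := by
  have hp : 2 ≤ p := Fact.out
  have hp0 : (p : ℝ≥0∞) ≠ 0 := by
    rw [Nat.cast_ne_zero]
    omega
  have hnorm : ∀ f : Lp ℝ (p : ℝ≥0∞) (PathSpace.timeMeasure t),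
      ‖f‖ ^ p = ∫ s, ‖f s‖ ^ p ∂PathSpace.timeMeasure t := fun f => by
    rw [Lp.norm_def, MemLp.eLpNorm_eq_integral_rpow_norm hp0 (ENNReal.natCast_ne_top p)
      (Lp.memLp f), ENNReal.toReal_ofReal (by positivity), ENNReal.toReal_natCast,
      Real.rpow_inv_natCast_pow (integral_nonneg fun _ => by positivity) (by omega)]
    simp only [Real.rpow_natCast]
  have hint : ∀ f : Lp ℝ (p : ℝ≥0∞) (PathSpace.timeMeasure t),
      Integrable (fun s => ‖f s‖ ^ p) (PathSpace.timeMeasure t) := fun f => by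
    simpa using (Lp.memLp f).integrable_norm_rpow hp0 (ENNReal.natCast_ne_top p)
  rw [PathSpace.integral_velocity_comp γ fun _ x => x ^ p, hnorm, hnorm, ← integral_const_mul,
    ← integral_add (hint _) ((hint _).const_mul _)]
  refine integral_congr_ae ?_
  filter_upwards [Lp.coeFn_posPart (PathSpace.toLpEquiv p t γ),
    Lp.coeFn_negPart_eq_max (PathSpace.toLpEquiv p t γ)] with s h1 h2
  rw [h1, h2]
  have hz : (0 : ℝ) ^ p = 0 := zero_pow (by omega)
  rcases le_total 0 ((PathSpace.toLpEquiv p t γ) s) with h | h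
  · rw [max_eq_left h, max_eq_right (neg_nonpos.2 h), Real.norm_of_nonneg h, norm_zero, hz]
    ring
  · rw [max_eq_right h, max_eq_left (neg_nonneg.2 h), Real.norm_of_nonneg (neg_nonneg.2 h),
      norm_zero, hz, ← mul_pow]
    ring

theorem continuous_pathPhase [Fact (2 ≤ p)] (α : ℂ) : Continuous (pathPhase p α (t := t)) := by
  have h : Continuous fun γ : PathSpace (p : ℝ≥0∞) t => ∫ s in (0 : ℝ)..t, γ.velocity s ^ p := by
    simp only [integral_velocity_pow_eq]
    have h1 := (PathSpace.toLpEquiv p t).continuous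
    exact ((Lp.continuous_posPart.comp h1).norm.pow p).add
      (((Lp.continuous_negPart.comp h1).norm.pow p).const_mul _)
  exact continuous_const.mul (Complex.continuous_ofReal.comp h)

theorem re_mul_pow_nonpos {p : ℕ} {α : ℂ}
    (hα : ∀ t : ℝ, 0 ≤ t → ∀ x : ℝ, ‖Complex.exp (α * t * x ^ p)‖ ≤ 1) (x : ℝ) :
    α.re * x ^ p ≤ 0 := by
  have h := hα 1 zero_le_one x
  rw [Complex.norm_exp, Real.exp_le_one_iff, Complex.ofReal_one, mul_one, ← Complex.ofReal_pow,
    Complex.re_mul_ofReal] at h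
  exact h

/-- Absorbing `(-1)^p` into the velocity makes ramps, which have velocity `-1`, contribute their
frequencies with a positive sign. -/
theorem pathPhase_eq (α : ℂ) (γ : PathSpace (p : ℝ≥0∞) t) :
    pathPhase p α γ = α * ((∫ s in (0 : ℝ)..t, (- γ.velocity s) ^ p : ℝ) : ℂ) := by
  have h : ∀ s, (- γ.velocity s) ^ p = (-1) ^ p * γ.velocity s ^ p := fun s => neg_pow _ _
  simp only [h, pathPhase]
  rw [intervalIntegral.integral_const_mul]
  push_cast
  ring

/-- The real part of the exponent is the integral of a nonpositive function. Integrability plays no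
role: an undefined integral is `0`, and the exponential is then `1`. -/
theorem norm_exp_mul_integral_pow_le {p : ℕ} {α : ℂ}
    (hα : ∀ t : ℝ, 0 ≤ t → ∀ x : ℝ, ‖Complex.exp (α * t * x ^ p)‖ ≤ 1) {t : ℝ} (ht : 0 ≤ t)
    (v : ℝ → ℝ) : ‖Complex.exp (α * ((∫ s in (0 : ℝ)..t, v s ^ p : ℝ) : ℂ))‖ ≤ 1 := by
  rw [Complex.norm_exp, Real.exp_le_one_iff, Complex.re_mul_ofReal,
    ← intervalIntegral.integral_const_mul]
  rw [intervalIntegral.integral_of_le ht]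
  exact integral_nonpos fun s => re_mul_pow_nonpos hα _

theorem norm_exp_pathPhase_le {α : ℂ}
    (hα : ∀ t : ℝ, 0 ≤ t → ∀ x : ℝ, ‖Complex.exp (α * t * x ^ p)‖ ≤ 1)
    (γ : PathSpace (p : ℝ≥0∞) t) : ‖Complex.exp (pathPhase p α γ)‖ ≤ 1 := by
  rw [pathPhase_eq]
  exact norm_exp_mul_integral_pow_le hα t.coe_nonneg _

end Phase

/-! ### Ramps: the paths representing the evaluations -/

section Ramp

variable {r : ℝ≥0∞} {t : ℝ≥0} [Fact (1 ≤ r)]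

/-- The path with velocity `-1` on `(s, t]` and `0` before `s`; pairing with it is evaluation at
`s`. -/
def ramp (r : ℝ≥0∞) (t : ℝ≥0) [Fact (1 ≤ r)] (s : ℝ) : PathSpace r t :=
  (PathSpace.toLpEquiv r t).symm
    (indicatorConstLp r (measurableSet_Ioi (a := s)) (measure_ne_top (PathSpace.timeMeasure t) _)
      (-1))

theorem toLpEquiv_ramp (s : ℝ) : PathSpace.toLpEquiv r t (ramp r t s) =ᵐ[PathSpace.timeMeasure t]
    (Ioi s).indicator fun _ => -1 := by
  rw [ramp, LinearIsometryEquiv.apply_symm_apply]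
  exact indicatorConstLp_coeFn

/-- The velocities of two ramps differ only between their starting times, so for finite `r` their
distance tends to `0` with the difference of these times. -/
theorem continuous_ramp (hr : r ≠ ∞) : Continuous (ramp r t) := by
  refine (PathSpace.toLpEquiv r t).symm.continuous.comp
    (continuous_indicatorConstLp_set hr fun x => ?_)
  have hle : ∀ y, PathSpace.timeMeasure t (symmDiff (Ioi y) (Ioi x)) ≤ ENNReal.ofReal |y - x| := by
    intro y
    refine (Measure.restrict_apply_le _ _).trans ?_
    refine (measure_mono (t := uIoc x y) ?_).trans ?_
    · intro u hu
      rw [mem_symmDiff] at hu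
      simp only [mem_Ioi, not_lt, mem_uIoc] at hu ⊢
      tauto
    · rw [Real.volume_uIoc]
  refine tendsto_of_tendsto_of_tendsto_of_le_of_le tendsto_const_nhds ?_ (fun _ => zero_le) hle
  have : Tendsto (fun y => ENNReal.ofReal |y - x|) (𝓝 x) (𝓝 (ENNReal.ofReal |x - x|)) := by
    refine (ENNReal.continuous_ofReal.comp ?_).tendsto x
    fun_prop
  simpa using this

/-- The path representing `η ↦ y₀ η(0) + ∑ yᵢ η(sᵢ)`. -/
def rampSum (r : ℝ≥0∞) (t : ℝ≥0) [Fact (1 ≤ r)] {n : ℕ} (s : Fin n → ℝ) (y₀ : ℝ) (y : Fin n → ℝ) :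
    PathSpace r t :=
  y₀ • ramp r t 0 + ∑ i, y i • ramp r t (s i)

/-- Joint continuity in times and frequencies provides the measurability needed to push measures
forward to the path space. -/
theorem continuous_rampSum (hr : r ≠ ∞) (n : ℕ) :
    Continuous fun a : (Fin n → ℝ) × ℝ × (Fin n → ℝ) => rampSum r t a.1 a.2.1 a.2.2 := by
  have := continuous_ramp (t := t) hr
  unfold rampSum
  fun_prop

theorem toLpEquiv_rampSum {n : ℕ} (s : Fin n → ℝ) (y₀ : ℝ) (y : Fin n → ℝ) :
    PathSpace.toLpEquiv r t (rampSum r t s y₀ y) =ᵐ[PathSpace.timeMeasure t]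
      fun u => -(y₀ + ∑ i, y i * (Ioi (s i)).indicator 1 u) := by
  have hsum : ∀ S : Finset (Fin n), PathSpace.toLpEquiv r t (∑ i ∈ S, y i • ramp r t (s i))
      =ᵐ[PathSpace.timeMeasure t] fun u => -∑ i ∈ S, y i * (Ioi (s i)).indicator 1 u := by
    intro S
    induction S using Finset.induction_on with
    | empty =>
      rw [Finset.sum_empty, map_zero]
      filter_upwards [Lp.coeFn_zero ℝ r (PathSpace.timeMeasure t)] with u hu
      simpa using hu
    | insert i S hi ih =>
      rw [Finset.sum_insert hi, map_add, map_smul]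
      filter_upwards [ih, Lp.coeFn_add (y i • PathSpace.toLpEquiv r t (ramp r t (s i)))
        (PathSpace.toLpEquiv r t (∑ i ∈ S, y i • ramp r t (s i))),
        Lp.coeFn_smul (y i) (PathSpace.toLpEquiv r t (ramp r t (s i))),
        toLpEquiv_ramp (r := r) (t := t) (s i)] with u h1 h2 h3 h4
      rw [h2, Pi.add_apply, h3, Pi.smul_apply, h1, h4, Finset.sum_insert hi]
      by_cases hu : u ∈ Ioi (s i) <;> simp [hu]
      ring
  -- The term with `y₀` appears without an indicator because `(0, t]` is almost all of `[0, t]`.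
  have hpos : ∀ᵐ u ∂PathSpace.timeMeasure t, u ∈ Ioi (0 : ℝ) := by
    rw [PathSpace.timeMeasure, ← Measure.restrict_congr_set Ioc_ae_eq_Icc]
    filter_upwards [ae_restrict_mem measurableSet_Ioc] with u hu using hu.1
  rw [rampSum, map_add, map_smul]
  filter_upwards [hsum Finset.univ, hpos, Lp.coeFn_add (y₀ • PathSpace.toLpEquiv r t (ramp r t 0))
    (PathSpace.toLpEquiv r t (∑ i, y i • ramp r t (s i))),
    Lp.coeFn_smul y₀ (PathSpace.toLpEquiv r t (ramp r t 0)),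
    toLpEquiv_ramp (r := r) (t := t) 0] with u h1 h0 h2 h3 h4
  rw [h2, Pi.add_apply, h3, Pi.smul_apply, h1, h4, indicator_of_mem h0]
  simp only [smul_eq_mul]
  ring

/-- The pairing is `-∫ₛᵗ η'`, and this equals `η(s)` because `η(t) = 0`. -/
theorem pathPairing_ramp {q : ℝ≥0∞} [Fact (1 ≤ q)] [ENNReal.HolderConjugate r q]
    (η : PathSpace q t) {s : ℝ} (hs : s ∈ Icc (0 : ℝ) t) :
    pathPairing η (ramp r t s) = η.eval s := by
  rw [η.eval_eq hs, ← intervalIntegral.integral_neg, intervalIntegral.integral_of_le hs.2,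
    pathPairing, intervalIntegral.integral_of_le t.coe_nonneg, ← integral_Icc_eq_integral_Ioc]
  have hset : Ioc s (t : ℝ) = Icc (0 : ℝ) t ∩ Ioi s := by
    ext u
    simp only [mem_Ioc, mem_inter_iff, mem_Icc, mem_Ioi]
    exact ⟨fun h => ⟨⟨hs.1.trans h.1.le, h.2⟩, h.1⟩, fun h => ⟨h.2, h.1.2⟩⟩
  rw [hset, ← setIntegral_indicator measurableSet_Ioi]
  refine integral_congr_ae ?_
  filter_upwards [toLpEquiv_ramp (r := r) (t := t) s, PathSpace.coeFn_toLpEquiv (ramp r t s)]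
    with u h1 h2
  rw [← h2, h1]
  by_cases hu : u ∈ Ioi s <;> simp [hu]

theorem pathPairing_rampSum {q : ℝ≥0∞} [Fact (1 ≤ q)] [ENNReal.HolderConjugate r q]
    (η : PathSpace q t) {n : ℕ} {s : Fin n → ℝ} (hs : ∀ i, s i ∈ Icc (0 : ℝ) t) (y₀ : ℝ)
    (y : Fin n → ℝ) :
    pathPairing η (rampSum r t s y₀ y) = y₀ * η.eval 0 + ∑ i, y i * η.eval (s i) := by
  rw [← pathPairingL_apply, rampSum, map_add, map_sum]
  simp only [map_smul, add_apply, sum_apply,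
    smul_apply, pathPairingL_apply, smul_eq_mul]
  rw [pathPairing_ramp η (left_mem_Icc.2 t.coe_nonneg)]
  congr 1
  exact Finset.sum_congr rfl fun i _ => by rw [pathPairing_ramp η (hs i)]

theorem pathPhase_rampSum (p : ℕ) [Fact (2 ≤ p)] (α : ℂ) {n : ℕ} (s : Fin n → ℝ) (y₀ : ℝ)
    (y : Fin n → ℝ) :
    pathPhase p α (rampSum p t s y₀ y) =
      α * ((∫ u in (0 : ℝ)..t, (y₀ + ∑ i, y i * (Ioi (s i)).indicator 1 u) ^ p : ℝ) : ℂ) := by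
  rw [pathPhase_eq]
  congr 2
  rw [PathSpace.integral_velocity_comp _ fun _ x => (-x) ^ p,
    intervalIntegral.integral_of_le t.coe_nonneg, ← integral_Icc_eq_integral_Ioc]
  refine integral_congr_ae ?_
  filter_upwards [toLpEquiv_rampSum (r := p) (t := t) s y₀ y] with u hu
  rw [hu, neg_neg]

end Ramp

/-! ### Bounded perturbations of contraction semigroups -/

section Perturbation

variable {H : Type*} [NormedAddCommGroup H] [NormedSpace ℂ H]

/-- A strongly continuous semigroup of contractions, extended to a strongly continuous family of
contractions on the whole line. -/
structure IsContractionFamily (E : ℝ → H →L[ℂ] H) : Prop where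
  map_zero : E 0 = 1
  map_add : ∀ s t, 0 ≤ s → 0 ≤ t → E (s + t) = E s ∘L E t
  continuous : ∀ u, Continuous fun t => E t u
  norm_le : ∀ t u, ‖E t u‖ ≤ ‖u‖

theorem IsContractionFamily.isC0Semigroup {E : ℝ → H →L[ℂ] H} (hE : IsContractionFamily E) :
    IsC0Semigroup E :=
  ⟨hE.map_zero, hE.map_add, fun u => (hE.continuous u).continuousOn⟩

/-- Strong continuity handles the time argument with the vector frozen, and contractivity controls
the change of the vector uniformly in time. -/
theorem IsContractionFamily.continuous_apply {E : ℝ → H →L[ℂ] H} (hE : IsContractionFamily E)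
    {X : Type*} [TopologicalSpace X] {τ : X → ℝ} {f : X → H} (hτ : Continuous τ)
    (hf : Continuous f) : Continuous fun x => E (τ x) (f x) := by
  rw [continuous_iff_continuousAt]
  intro x
  have h1 : Tendsto (fun y => E (τ y) (f x)) (𝓝 x) (𝓝 (E (τ x) (f x))) :=
    ((hE.continuous (f x)).comp hτ).tendsto x
  have h2 : Tendsto (fun y => E (τ y) (f y - f x)) (𝓝 x) (𝓝 0) := by
    refine squeeze_zero_norm (fun y => hE.norm_le _ _) ?_
    have : Tendsto (fun y => ‖f y - f x‖) (𝓝 x) (𝓝 ‖f x - f x‖) :=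
      ((hf.sub continuous_const).norm).tendsto x
    simpa using this
  have h3 := h2.add h1
  rw [zero_add] at h3
  refine h3.congr fun y => ?_
  rw [map_sub, sub_add_cancel]

/-- The terms of the Dyson series for a bounded perturbation `B`. -/
def boundedDyson (E : ℝ → H →L[ℂ] H) (B : H →L[ℂ] H) : ℕ → ℝ → H → H
  | 0, t, u => E t u
  | n + 1, t, u => ∫ s in (0 : ℝ)..t, E (t - s) (B (boundedDyson E B n s u))

variable {E : ℝ → H →L[ℂ] H} (hE : IsContractionFamily E) (B : H →L[ℂ] H)

/-- The integral operator of Duhamel's formula. -/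
def duhamel (E : ℝ → H →L[ℂ] H) (B : H →L[ℂ] H) (f : ℝ → H) (t : ℝ) : H :=
  ∫ s in (0 : ℝ)..t, E (t - s) (B (f s))

include hE

theorem continuous_duhamel {f : ℝ → H} (hf : Continuous f) : Continuous (duhamel E B f) := by
  unfold duhamel
  refine intervalIntegral.continuous_parametric_intervalIntegral_of_continuous ?_ continuous_id
  exact hE.continuous_apply (τ := fun x : ℝ × ℝ => x.1 - x.2) (f := fun x => B (f x.2))
    (by fun_prop) (by fun_prop)

theorem intervalIntegrable_duhamel {f : ℝ → H} (hf : Continuous f) (t a b : ℝ) :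
    IntervalIntegrable (fun s => E (t - s) (B (f s))) volume a b :=
  (hE.continuous_apply (τ := fun s : ℝ => t - s) (f := fun s => B (f s)) (by fun_prop)
    (by fun_prop)).intervalIntegrable _ _

/-- One Duhamel integration raises the power of `‖B‖ s` by one and supplies the next factor of the
factorial. The estimate is iterated twice below: to bound the Dyson terms, and to prove uniqueness
for the integral equation. -/
theorem norm_duhamel_le {f : ℝ → H} {M τ : ℝ} {n : ℕ}
    (hf : ∀ s ∈ Icc 0 τ, ‖f s‖ ≤ M * (‖B‖ * s) ^ n / n.factorial) {t : ℝ} (ht : t ∈ Icc 0 τ) :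
    ‖duhamel E B f t‖ ≤ M * (‖B‖ * t) ^ (n + 1) / (n + 1).factorial := by
  have h1 : ‖duhamel E B f t‖ ≤
      ∫ s in (0 : ℝ)..t, ‖B‖ ^ (n + 1) * M / n.factorial * s ^ n := by
    refine intervalIntegral.norm_integral_le_of_norm_le ht.1 (ae_of_all _ fun s hs => ?_)
      ((by fun_prop : Continuous fun s : ℝ =>
        ‖B‖ ^ (n + 1) * M / n.factorial * s ^ n).intervalIntegrable _ _)
    refine (hE.norm_le _ _).trans ((B.le_opNorm _).trans ?_)
    refine (mul_le_mul_of_nonneg_left (hf s ⟨hs.1.le, hs.2.trans ht.2⟩) (norm_nonneg _)).trans_eq ?_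
    ring
  refine h1.trans_eq ?_
  rw [intervalIntegral.integral_const_mul, integral_pow, Nat.factorial_succ]
  have : (n.factorial : ℝ) ≠ 0 := by positivity
  push_cast
  field_simp
  ring

theorem continuous_boundedDyson (n : ℕ) (u : H) : Continuous fun t => boundedDyson E B n t u := by
  induction n with
  | zero => exact hE.continuous u
  | succ n ih => exact continuous_duhamel hE B ih

theorem norm_boundedDyson_le (n : ℕ) (u : H) {t : ℝ} (ht : 0 ≤ t) :
    ‖boundedDyson E B n t u‖ ≤ ‖u‖ * (‖B‖ * t) ^ n / n.factorial := by
  induction n generalizing t with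
  | zero => simpa using! hE.norm_le t u
  | succ n ih => exact norm_duhamel_le hE B (τ := t) (fun s hs => ih hs.1) (right_mem_Icc.2 ht)

theorem norm_boundedDyson_le_of_le (n : ℕ) (u : H) {t τ : ℝ} (ht : 0 ≤ t) (hτ : t ≤ τ) :
    ‖boundedDyson E B n t u‖ ≤ ‖u‖ * (‖B‖ * τ) ^ n / n.factorial := by
  refine (norm_boundedDyson_le hE B n u ht).trans ?_
  gcongr

omit hE in
theorem summable_dysonBound (M K : ℝ) : Summable fun n : ℕ => M * K ^ n / n.factorial := by
  simpa only [mul_div_assoc] using (Real.summable_pow_div_factorial K).mul_left M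

theorem boundedDyson_add (n : ℕ) (t : ℝ) (u v : H) :
    boundedDyson E B n t (u + v) = boundedDyson E B n t u + boundedDyson E B n t v := by
  induction n generalizing t with
  | zero => exact map_add _ _ _
  | succ n ih =>
    simp only [boundedDyson, ih, map_add]
    exact intervalIntegral.integral_add
      (intervalIntegrable_duhamel hE B (continuous_boundedDyson hE B n u) _ _ _)
      (intervalIntegrable_duhamel hE B (continuous_boundedDyson hE B n v) _ _ _)

omit hE in
theorem boundedDyson_smul (n : ℕ) (t : ℝ) (c : ℂ) (u : H) :
    boundedDyson E B n t (c • u) = c • boundedDyson E B n t u := by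
  induction n generalizing t with
  | zero => exact map_smul _ _ _
  | succ n ih =>
    simp only [boundedDyson, ih, map_smul]
    exact intervalIntegral.integral_smul _ _

variable [CompleteSpace H]

theorem hasSum_boundedDyson_tsum (u : H) {t : ℝ} (ht : 0 ≤ t) :
    HasSum (fun n => boundedDyson E B n t u) (∑' n, boundedDyson E B n t u) :=
  (Summable.of_norm_bounded (summable_dysonBound ‖u‖ (‖B‖ * t))
    fun n => norm_boundedDyson_le hE B n u ht).hasSum

/-- The perturbed semigroup, defined as the sum of the Dyson series. -/
def perturbed (t : ℝ) : H →L[ℂ] H :=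
  LinearMap.mkContinuous
    -- Negative times are replaced by `0`, so that the factorial bound applies for every real `t`.
    { toFun := fun u => ∑' n, boundedDyson E B n (max t 0) u
      map_add' := fun u v => by
        simp only [boundedDyson_add hE B]
        exact ((hasSum_boundedDyson_tsum hE B u (le_max_right _ _)).add
          (hasSum_boundedDyson_tsum hE B v (le_max_right _ _))).tsum_eq
      map_smul' := fun c u => by
        simp only [boundedDyson_smul B, RingHom.id_apply]
        exact ((hasSum_boundedDyson_tsum hE B u (le_max_right _ _)).const_smul c).tsum_eq }
    (Real.exp (‖B‖ * max t 0)) fun u => by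
      change ‖∑' n, boundedDyson E B n (max t 0) u‖ ≤ _
      refine tsum_of_norm_bounded ?_ fun n => norm_boundedDyson_le hE B n u (le_max_right _ _)
      have := (NormedSpace.expSeries_div_hasSum_exp (𝔸 := ℝ) (‖B‖ * max t 0)).mul_left ‖u‖
      rw [← Real.exp_eq_exp_ℝ] at this
      rw [mul_comm (Real.exp _)]
      simpa only [mul_div_assoc] using this

theorem hasSum_perturbed (u : H) {t : ℝ} (ht : 0 ≤ t) :
    HasSum (fun n => boundedDyson E B n t u) (perturbed hE B t u) := by
  have h := hasSum_boundedDyson_tsum hE B u ht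
  have e : perturbed hE B t u = ∑' n, boundedDyson E B n (max t 0) u := rfl
  rw [e, max_eq_left ht]
  exact h

/-- Cutting the time off at `|t₀| + 1` makes the factorial bounds uniform in `t` without changing
the series near `t₀`, so the Weierstrass test applies. -/
theorem continuous_perturbed (u : H) : Continuous fun t => perturbed hE B t u := by
  rw [continuous_iff_continuousAt]
  intro t₀
  set τ := |t₀| + 1 with hτ
  have h1 : Continuous fun t => ∑' n, boundedDyson E B n (max (min t τ) 0) u := by
    refine continuous_tsum (fun n => (continuous_boundedDyson hE B n u).comp (by fun_prop))
      (summable_dysonBound ‖u‖ (‖B‖ * τ)) fun n t =>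
        norm_boundedDyson_le_of_le hE B n u (le_max_right _ _)
          (max_le (min_le_right _ _) (by positivity))
  refine h1.continuousAt.congr ?_
  filter_upwards [Iio_mem_nhds (show t₀ < τ by rw [hτ]; linarith [le_abs_self t₀])] with t ht
  rw [min_eq_left (le_of_lt ht)]
  rfl

/-- The Duhamel operator maps each Dyson term to the next one and may be applied termwise by
dominated convergence; the term of index `0` is what remains. -/
theorem perturbed_eq_duhamel (u : H) {t : ℝ} (ht : 0 ≤ t) :
    perturbed hE B t u = E t u + duhamel E B (fun s => perturbed hE B s u) t := by
  have h1 := hasSum_perturbed hE B u ht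
  have h2 : HasSum (fun n => boundedDyson E B (n + 1) t u)
      (duhamel E B (fun s => perturbed hE B s u) t) := by
    refine intervalIntegral.hasSum_integral_of_dominated_convergence
      (fun n _ => ‖B‖ * (‖u‖ * (‖B‖ * t) ^ n / n.factorial)) (fun n => ?_) (fun n => ?_) ?_ ?_ ?_
    · exact (hE.continuous_apply (τ := fun s : ℝ => t - s) (by fun_prop)
        (B.continuous.comp (continuous_boundedDyson hE B n u))).aestronglyMeasurable
    · refine ae_of_all _ fun s hs => ?_
      rw [uIoc_of_le ht] at hs
      refine (hE.norm_le _ _).trans ((B.le_opNorm _).trans ?_)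
      exact mul_le_mul_of_nonneg_left (norm_boundedDyson_le_of_le hE B n u hs.1.le hs.2)
        (norm_nonneg _)
    · exact ae_of_all _ fun s _ => (summable_dysonBound _ _).mul_left _
    · exact intervalIntegrable_const
    · refine ae_of_all _ fun s hs => ?_
      rw [uIoc_of_le ht] at hs
      exact ((hasSum_perturbed hE B u hs.1.le).mapL B).mapL (E (t - s))
  have h3 := (hasSum_nat_add_iff (f := fun n => boundedDyson E B n t u) 1).1 h2
  rw [Finset.sum_range_one, add_comm] at h3
  exact h1.unique h3

omit [CompleteSpace H] in
-- Iterating the equation bounds `‖w t‖` by `M (‖B‖ t)^n / n!` for every `n`, and this tends to `0`.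
theorem eq_zero_of_eq_duhamel {w : ℝ → H} (hw : Continuous w)
    (h : ∀ t, 0 ≤ t → w t = duhamel E B w t) {t : ℝ} (ht : 0 ≤ t) : w t = 0 := by
  obtain ⟨M, hM⟩ := isCompact_Icc.exists_bound_of_continuousOn (s := Icc 0 t) hw.continuousOn
  have key : ∀ n : ℕ, ∀ s ∈ Icc 0 t, ‖w s‖ ≤ M * (‖B‖ * s) ^ n / n.factorial := by
    intro n
    induction n with
    | zero => simpa using hM
    | succ n ih =>
      intro s hs
      rw [h s hs.1]
      exact norm_duhamel_le hE B ih hs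
  have hlim := (summable_dysonBound M (‖B‖ * t)).tendsto_atTop_zero
  have := ge_of_tendsto' hlim fun n => key n t (right_mem_Icc.2 ht)
  exact norm_le_zero_iff.1 this

/-- As functions of the first time, both sides solve the Duhamel equation with initial value
`perturbed hE B t u`. Their difference solves the homogeneous equation and hence vanishes. -/
theorem perturbed_add (s t : ℝ) (hs : 0 ≤ s) (ht : 0 ≤ t) :
    perturbed hE B (s + t) = perturbed hE B s ∘L perturbed hE B t := by
  ext u
  set w : ℝ → H := fun r => perturbed hE B (r + t) u - perturbed hE B r (perturbed hE B t u) with hw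
  have c0 := continuous_perturbed hE B u
  have c1 : Continuous fun r => perturbed hE B (r + t) u := c0.comp (by fun_prop)
  have c2 := continuous_perturbed hE B (perturbed hE B t u)
  rw [ContinuousLinearMap.comp_apply, ← sub_eq_zero]
  refine eq_zero_of_eq_duhamel hE B (w := w) (c1.sub c2) (fun r hr => ?_) hs
  have e1 : duhamel E B w r = duhamel E B (fun a => perturbed hE B (a + t) u) r -
      duhamel E B (fun a => perturbed hE B a (perturbed hE B t u)) r := by
    rw [duhamel, duhamel, duhamel, ← intervalIntegral.integral_sub
      (intervalIntegrable_duhamel hE B c1 _ _ _) (intervalIntegrable_duhamel hE B c2 _ _ _)]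
    simp only [hw, map_sub]
  -- Split the Duhamel integral at `t`: the part before `t` is `E r` applied to the Duhamel term at
  -- time `t`, and the part after it becomes a Duhamel term on `[0, r]` by translation.
  have e2 : perturbed hE B (r + t) u = E r (perturbed hE B t u) +
      duhamel E B (fun a => perturbed hE B (a + t) u) r := by
    rw [perturbed_eq_duhamel hE B u (add_nonneg hr ht), duhamel,
      ← intervalIntegral.integral_add_adjacent_intervals
        (intervalIntegrable_duhamel hE B c0 (r + t) 0 t)
        (intervalIntegrable_duhamel hE B c0 (r + t) t (r + t))]
    have e3 : ∫ a in (0 : ℝ)..t, E (r + t - a) (B (perturbed hE B a u)) =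
        E r (duhamel E B (fun a => perturbed hE B a u) t) := by
      rw [duhamel, ← ContinuousLinearMap.intervalIntegral_comp_comm _
        (intervalIntegrable_duhamel hE B c0 t 0 t)]
      refine intervalIntegral.integral_congr fun a ha => ?_
      rw [uIcc_of_le ht] at ha
      rw [add_sub_assoc, hE.map_add r (t - a) hr (sub_nonneg.2 ha.2)]
      rfl
    have e4 : ∫ a in t..(r + t), E (r + t - a) (B (perturbed hE B a u)) =
        duhamel E B (fun a => perturbed hE B (a + t) u) r := by
      have := intervalIntegral.integral_comp_add_right (a := 0) (b := r)
        (fun a => E (r + t - a) (B (perturbed hE B a u))) t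
      rw [zero_add] at this
      rw [← this, duhamel]
      simp only [add_sub_add_right_eq_sub]
    rw [e3, e4, ← add_assoc, hE.map_add r t hr ht, ContinuousLinearMap.comp_apply, ← map_add,
      ← perturbed_eq_duhamel hE B u ht]
  rw [e1, hw]
  dsimp only
  rw [e2, perturbed_eq_duhamel hE B (perturbed hE B t u) hr]
  abel

theorem isC0Semigroup_perturbed : IsC0Semigroup (perturbed hE B) where
  map_zero := by
    ext u
    rw [perturbed_eq_duhamel hE B u le_rfl, duhamel, intervalIntegral.integral_same, add_zero,
      hE.map_zero]
  map_add := perturbed_add hE B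
  continuousOn := fun u => (continuous_perturbed hE B u).continuousOn

/-- This is the average over `[0, h]` of a jointly continuous integrand whose value at the origin is
`B (w 0)`. -/
theorem tendsto_inv_smul_duhamel {w : ℝ → H} (hw : Continuous w) :
    Tendsto (fun h : ℝ => ((h : ℂ)⁻¹) • duhamel E B w h) (𝓝[>] 0) (𝓝 (B (w 0))) := by
  have hF : Continuous fun x : ℝ × ℝ => E (x.1 - x.2) (B (w x.2)) :=
    hE.continuous_apply (τ := fun x : ℝ × ℝ => x.1 - x.2) (f := fun x => B (w x.2))
      (by fun_prop) (by fun_prop)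
  rw [Metric.tendsto_nhds]
  intro ε hε
  have h0 := Metric.continuous_iff.1 hF (0, 0) (ε / 2) (by positivity)
  obtain ⟨δ, hδ, h1⟩ := h0
  filter_upwards [Ioo_mem_nhdsGT hδ] with h hh
  have hne : (h : ℂ) ≠ 0 := by exact_mod_cast hh.1.ne'
  have e : ((h : ℂ)⁻¹) • duhamel E B w h - B (w 0) =
      ((h : ℂ)⁻¹) • ∫ s in (0 : ℝ)..h, (E (h - s) (B (w s)) - B (w 0)) := by
    rw [intervalIntegral.integral_sub (intervalIntegrable_duhamel hE B hw _ _ _)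
      intervalIntegrable_const, intervalIntegral.integral_const, sub_zero, smul_sub,
      ← Complex.coe_smul h (B (w 0)), smul_smul, inv_mul_cancel₀ hne, one_smul]
    rfl
  rw [dist_eq_norm, e, norm_smul, norm_inv, Complex.norm_real, Real.norm_of_nonneg hh.1.le]
  have h2 : ‖∫ s in (0 : ℝ)..h, (E (h - s) (B (w s)) - B (w 0))‖ ≤ ε / 2 * |h - 0| := by
    refine intervalIntegral.norm_integral_le_of_norm_le_const fun s hs => ?_
    rw [uIoc_of_le hh.1.le] at hs
    have h3 := h1 (h, s) (by
      rw [Prod.dist_eq, max_lt_iff, Real.dist_eq, Real.dist_eq, sub_zero, sub_zero,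
        abs_of_pos hh.1, abs_of_pos hs.1]
      exact ⟨hh.2, hs.2.trans_lt hh.2⟩)
    rw [dist_eq_norm] at h3
    simp only [sub_zero, hE.map_zero] at h3
    exact h3.le
  rw [sub_zero, abs_of_pos hh.1] at h2
  calc h⁻¹ * ‖∫ s in (0 : ℝ)..h, (E (h - s) (B (w s)) - B (w 0))‖ ≤ h⁻¹ * (ε / 2 * h) :=
        mul_le_mul_of_nonneg_left h2 (inv_nonneg.2 hh.1.le)
    _ = ε / 2 := by
        have := hh.1.ne'
        field_simp
    _ < ε := by linarith

/-- By Duhamel's formula the two difference quotients differ by a term converging to `B u`, so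
either converges exactly when the other does. The generator is thus perturbed by `B` with unchanged
domain. -/
theorem tendsto_perturbed_iff (u v : H) :
    Tendsto (fun h : ℝ => ((h : ℂ)⁻¹) • (perturbed hE B h u - u)) (𝓝[>] 0) (𝓝 v) ↔
      Tendsto (fun h : ℝ => ((h : ℂ)⁻¹) • (E h u - u)) (𝓝[>] 0) (𝓝 (v - B u)) := by
  have h0 := tendsto_inv_smul_duhamel hE B (continuous_perturbed hE B u)
  rw [(isC0Semigroup_perturbed hE B).map_zero] at h0
  have e : ∀ᶠ h : ℝ in 𝓝[>] 0, ((h : ℂ)⁻¹) • (perturbed hE B h u - u) =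
      ((h : ℂ)⁻¹) • (E h u - u) +
        ((h : ℂ)⁻¹) • duhamel E B (fun s => perturbed hE B s u) h := by
    filter_upwards [self_mem_nhdsWithin] with h hh
    rw [perturbed_eq_duhamel hE B u (le_of_lt hh), ← smul_add]
    congr 1
    abel
  constructor
  · intro h
    refine (h.sub h0).congr' ?_
    filter_upwards [e] with h hh
    rw [hh, add_sub_cancel_right]
  · intro h
    have h1 := h.add h0
    change Tendsto _ _ (𝓝 (v - B u + B u)) at h1
    rw [sub_add_cancel] at h1
    exact h1.congr' (e.mono fun h hh => hh.symm)

end Perturbation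

/-! ### Multiplication semigroups on `L²(ℝ)` -/

section Multiplication

/-- Dominated convergence in `L²` through chosen representatives `f i`, so that limits of operators
can be computed pointwise. -/
theorem tendsto_L2_of_dominated {ι : Type*} {l : Filter ι} [l.IsCountablyGenerated]
    {F : ι → L2R} {G : L2R} (f : ι → ℝ → ℂ) {b : ℝ → ℝ} (hb : MemLp b 2 volume)
    (hf : ∀ᶠ i in l, F i =ᵐ[volume] f i) (hbound : ∀ᶠ i in l, ∀ᵐ x, ‖f i x - G x‖ ≤ b x)
    (hlim : ∀ᵐ x, Tendsto (fun i => f i x) l (𝓝 (G x))) : Tendsto F l (𝓝 G) := by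
  rw [Lp.tendsto_Lp_iff_tendsto_eLpNorm']
  have h2 : (2 : ℝ≥0∞).toReal = 2 := by simp
  have e : ∀ᶠ i in l, (∫⁻ x, ‖f i x - G x‖ₑ ^ (2 : ℝ)) ^ (1 / (2 : ℝ)) =
      eLpNorm (⇑(F i) - ⇑G) 2 volume := by
    filter_upwards [hf] with i hi
    rw [eLpNorm_congr_ae (hi.sub EventuallyEq.rfl),
      eLpNorm_eq_lintegral_rpow_enorm_toReal two_ne_zero ENNReal.ofNat_ne_top, h2]
    rfl
  refine Tendsto.congr' e ?_
  have h3 : Tendsto (fun i => ∫⁻ x, ‖f i x - G x‖ₑ ^ (2 : ℝ)) l (𝓝 (∫⁻ _ : ℝ, 0)) := by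
    refine tendsto_lintegral_filter_of_dominated_convergence' (fun x => ‖b x‖ₑ ^ (2 : ℝ)) ?_ ?_ ?_ ?_
    · filter_upwards [hf] with i hi
      exact (((Lp.aestronglyMeasurable (F i)).congr hi).sub
        (Lp.aestronglyMeasurable G)).enorm.pow_const _
    · filter_upwards [hbound] with i hi
      filter_upwards [hi] with x hx
      refine ENNReal.rpow_le_rpow (enorm_le_iff_norm_le.2 (hx.trans (le_abs_self _))) zero_le_two
    · have := lintegral_rpow_enorm_lt_top_of_eLpNorm_lt_top two_ne_zero ENNReal.ofNat_ne_top hb.2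
      rw [h2] at this
      exact this.ne
    · filter_upwards [hlim] with x hx
      have h4 : Tendsto (fun i => ‖f i x - G x‖ₑ ^ (2 : ℝ)) l (𝓝 (‖G x - G x‖ₑ ^ (2 : ℝ))) :=
        ((hx.sub_const _).enorm).ennrpow_const _
      simpa using h4
  rw [lintegral_zero] at h3
  have h5 := h3.ennrpow_const (1 / (2 : ℝ))
  simpa using h5

variable {m : ℝ → ℂ}

theorem memLp_mul_of_bounded (hm : AEStronglyMeasurable m) {C : ℝ} (hC : ∀ x, ‖m x‖ ≤ C)
    (u : L2R) : MemLp (fun x => m x * u x) 2 volume :=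
  MemLp.of_le_mul (c := C) (Lp.memLp u) (hm.mul (Lp.aestronglyMeasurable u))
    (ae_of_all _ fun x => by
      rw [norm_mul]
      exact mul_le_mul_of_nonneg_right (hC x) (norm_nonneg _))

/-- Multiplication by a bounded function as a bounded operator. -/
def boundedMul (hm : AEStronglyMeasurable m) {C : ℝ} (hC : ∀ x, ‖m x‖ ≤ C) : L2R →L[ℂ] L2R :=
  LinearMap.mkContinuous
    { toFun := fun u => (memLp_mul_of_bounded hm hC u).toLp
      map_add' := fun u v => by
        rw [← MemLp.toLp_add]
        refine (MemLp.toLp_eq_toLp_iff _ _).2 ?_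
        filter_upwards [Lp.coeFn_add u v] with x hx
        rw [hx, Pi.add_apply, mul_add]
        rfl
      map_smul' := fun c u => by
        rw [RingHom.id_apply, ← MemLp.toLp_const_smul]
        refine (MemLp.toLp_eq_toLp_iff _ _).2 ?_
        filter_upwards [Lp.coeFn_smul c u] with x hx
        simp [hx, mul_left_comm] } C fun u => by
    refine Lp.norm_le_mul_norm_of_ae_le_mul ?_
    filter_upwards [(memLp_mul_of_bounded hm hC u).coeFn_toLp] with x hx
    change ‖((memLp_mul_of_bounded hm hC u).toLp) x‖ ≤ _
    rw [hx, norm_mul]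
    exact mul_le_mul_of_nonneg_right (hC x) (norm_nonneg _)

theorem coeFn_boundedMul (hm : AEStronglyMeasurable m) {C : ℝ} (hC : ∀ x, ‖m x‖ ≤ C) (u : L2R) :
    boundedMul hm hC u =ᵐ[volume] fun x => m x * u x :=
  (memLp_mul_of_bounded hm hC u).coeFn_toLp

theorem mulL2_eq_boundedMul (hm : AEStronglyMeasurable m) {C : ℝ} (hC : ∀ x, ‖m x‖ ≤ C) (u : L2R) :
    mulL2 m u = boundedMul hm hC u := by
  have h : u ∈ (mulOp m).domain := memLp_mul_of_bounded hm hC u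
  rw [mulL2, dif_pos h]
  rfl

theorem mem_graph_add_mulOp (A : L2R →ₗ.[ℂ] L2R) (hm : AEStronglyMeasurable m) {C : ℝ}
    (hC : ∀ x, ‖m x‖ ≤ C) (u v : L2R) :
    (u, v) ∈ (A + mulOp m).graph ↔ (u, v - boundedMul hm hC u) ∈ A.graph := by
  have hd : ∀ u, u ∈ (mulOp m).domain := fun u => memLp_mul_of_bounded hm hC u
  rw [LinearPMap.mem_graph_iff, LinearPMap.mem_graph_iff]
  constructor
  · rintro ⟨y, rfl, rfl⟩
    refine ⟨⟨y, y.2.1⟩, rfl, ?_⟩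
    rw [LinearPMap.add_apply]
    exact (add_sub_cancel_right _ _).symm
  · rintro ⟨y, rfl, h⟩
    refine ⟨⟨y, y.2, hd _⟩, rfl, ?_⟩
    rw [LinearPMap.add_apply]
    exact (congrArg (· + boundedMul hm hC (y : L2R)) h).trans (sub_add_cancel _ _)

theorem mem_graph_mulOp (u v : L2R) :
    (u, v) ∈ (mulOp m).graph ↔ v =ᵐ[volume] fun x => m x * u x := by
  rw [LinearPMap.mem_graph_iff]
  constructor
  · rintro ⟨y, rfl, rfl⟩
    exact MemLp.coeFn_toLp (show MemLp (fun x => m x * y.1 x) 2 volume from y.2)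
  · intro h
    have h2 : MemLp (fun x => m x * u x) 2 volume := (memLp_congr_ae h).1 (Lp.memLp v)
    refine ⟨⟨u, h2⟩, rfl, ?_⟩
    exact Lp.ext ((MemLp.coeFn_toLp h2).trans h.symm)

variable (hm : Measurable m) (hre : ∀ x, (m x).re ≤ 0)

theorem norm_exp_mul_le_one {z : ℂ} (hz : z.re ≤ 0) {t : ℝ} (ht : 0 ≤ t) :
    ‖Complex.exp (t * z)‖ ≤ 1 := by
  rw [Complex.norm_exp, Real.exp_le_one_iff, Complex.re_ofReal_mul]
  exact mul_nonpos_of_nonneg_of_nonpos ht hz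

/-- For `‖z‖ ≥ 1` the left side is at most `2`. The linear bound on the whole half plane dominates
the difference quotients in the computation of the generator. -/
theorem norm_exp_sub_one_le_of_re_nonpos {z : ℂ} (hz : z.re ≤ 0) :
    ‖Complex.exp z - 1‖ ≤ 2 * ‖z‖ := by
  rcases le_total ‖z‖ 1 with h | h
  · exact Complex.norm_exp_sub_one_le h
  · have h1 : ‖Complex.exp z‖ ≤ 1 := by
      rw [Complex.norm_exp]
      exact Real.exp_le_one_iff.2 hz
    have h2 := norm_sub_le (Complex.exp z) 1
    rw [norm_one] at h2
    linarith

include hm in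
theorem aestronglyMeasurable_expMul (t : ℝ) :
    AEStronglyMeasurable fun x => Complex.exp ((max t 0 : ℝ) * m x) :=
  (Complex.measurable_exp.comp (hm.const_mul _)).aestronglyMeasurable

/-- The semigroup of multiplication by `exp (t m)`, constant for negative times. -/
def expMul (t : ℝ) : L2R →L[ℂ] L2R :=
  boundedMul (aestronglyMeasurable_expMul hm t) (C := 1)
    fun x => norm_exp_mul_le_one (hre x) (le_max_right t 0)

theorem coeFn_expMul (t : ℝ) (u : L2R) :
    expMul hm hre t u =ᵐ[volume] fun x => Complex.exp ((max t 0 : ℝ) * m x) * u x :=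
  coeFn_boundedMul _ _ _

theorem isContractionFamily_expMul : IsContractionFamily (expMul hm hre) where
  map_zero := by
    ext1 u
    refine Lp.ext ?_
    filter_upwards [coeFn_expMul hm hre 0 u] with x hx
    rw [hx]
    simp
  map_add s t hs ht := by
    ext1 u
    refine Lp.ext ?_
    filter_upwards [coeFn_expMul hm hre (s + t) u, coeFn_expMul hm hre t u,
      coeFn_expMul hm hre s (expMul hm hre t u)] with x h1 h2 h3
    rw [ContinuousLinearMap.comp_apply, h3, h2, h1, max_eq_left hs, max_eq_left ht,
      max_eq_left (add_nonneg hs ht), ← mul_assoc, ← Complex.exp_add]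
    push_cast
    ring_nf
  continuous u := by
    rw [continuous_iff_continuousAt]
    intro t
    refine tendsto_L2_of_dominated (fun s x => Complex.exp ((max s 0 : ℝ) * m x) * u x)
      ((Lp.memLp u).norm.const_mul 2) (Eventually.of_forall fun s => coeFn_expMul hm hre s u)
      (Eventually.of_forall fun s => ?_) ?_
    · filter_upwards [coeFn_expMul hm hre t u] with x hx
      rw [hx, ← sub_mul, norm_mul]
      refine mul_le_mul_of_nonneg_right ((norm_sub_le _ _).trans ?_) (norm_nonneg _)
      have h1 := norm_exp_mul_le_one (hre x) (le_max_right s 0)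
      have h2 := norm_exp_mul_le_one (hre x) (le_max_right t 0)
      linarith
    · filter_upwards [coeFn_expMul hm hre t u] with x hx
      rw [hx]
      have : Continuous fun s : ℝ => Complex.exp ((max s 0 : ℝ) * m x) * u x := by fun_prop
      exact this.tendsto t
  norm_le t u := by
    have h : ‖expMul hm hre t u‖ ≤ 1 * ‖u‖ := by
      refine Lp.norm_le_mul_norm_of_ae_le_mul ?_
      filter_upwards [coeFn_expMul hm hre t u] with x hx
      rw [hx, norm_mul]
      exact mul_le_mul_of_nonneg_right (norm_exp_mul_le_one (hre x) (le_max_right t 0))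
        (norm_nonneg _)
    rwa [one_mul] at h

/-- The difference quotients always converge pointwise to `m u`. If `m u` is in `L²`, domination
upgrades this to `L²` convergence; conversely, an `L²` limit is an almost everywhere limit along a
sequence and must equal `m u`. This identifies the full domain. -/
theorem isGenerator_expMul : IsGenerator (mulOp m) (expMul hm hre) := by
  intro u v
  rw [mem_graph_mulOp]
  set f : ℝ → ℝ → ℂ := fun h x => (h : ℂ)⁻¹ * ((Complex.exp (h * m x) - 1) * u x) with hf
  have hF : ∀ᶠ h : ℝ in 𝓝[>] 0,
      (((h : ℂ)⁻¹) • (expMul hm hre h u - u) : L2R) =ᵐ[volume] f h := by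
    filter_upwards [self_mem_nhdsWithin] with h hh
    filter_upwards [Lp.coeFn_smul ((h : ℂ)⁻¹) (expMul hm hre h u - u),
      Lp.coeFn_sub (expMul hm hre h u) u, coeFn_expMul hm hre h u] with x h1 h2 h3
    rw [h1, Pi.smul_apply, h2, Pi.sub_apply, h3, max_eq_left (le_of_lt hh), smul_eq_mul, hf]
    ring
  have hlim : ∀ x, Tendsto (fun h => f h x) (𝓝[>] 0) (𝓝 (m x * u x)) := by
    intro x
    have hd : HasDerivAt (fun h : ℝ => Complex.exp (h * m x)) (m x) 0 := by
      have h1 : HasDerivAt (fun h : ℂ => Complex.exp (h * m x)) (m x) ((0 : ℝ) : ℂ) := by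
        have := ((hasDerivAt_id ((0 : ℝ) : ℂ)).mul_const (m x)).cexp
        simpa using this
      exact h1.comp_ofReal
    have h2 := hd.tendsto_slope_zero_right
    have h3 := h2.mul_const (u x)
    refine h3.congr fun h => ?_
    simp only [zero_add, Complex.ofReal_zero, zero_mul, Complex.exp_zero, hf, Complex.real_smul,
      Complex.ofReal_inv]
    ring
  constructor
  · intro hv
    -- Of the constant `3`, the quotient accounts for `2` and its limit for `1`.
    refine tendsto_L2_of_dominated f ((Lp.memLp v).norm.const_mul 3) hF ?_ ?_
    · filter_upwards [self_mem_nhdsWithin] with h hh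
      filter_upwards [hv] with x hx
      rw [hx]
      have hpos : (0 : ℝ) < h := hh
      refine (norm_sub_le _ _).trans ?_
      have h1 : ‖Complex.exp (h * m x) - 1‖ ≤ 2 * (h * ‖m x‖) := by
        have := norm_exp_sub_one_le_of_re_nonpos (z := h * m x) (by
          rw [Complex.re_ofReal_mul]
          exact mul_nonpos_of_nonneg_of_nonpos hpos.le (hre x))
        rwa [norm_mul, Complex.norm_real, Real.norm_of_nonneg hpos.le] at this
      have h2 : ‖f h x‖ ≤ 2 * (‖m x‖ * ‖u x‖) := by
        rw [hf]
        dsimp only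
        rw [norm_mul, norm_mul, norm_inv, Complex.norm_real, Real.norm_of_nonneg hpos.le]
        calc h⁻¹ * (‖Complex.exp (h * m x) - 1‖ * ‖u x‖)
            ≤ h⁻¹ * (2 * (h * ‖m x‖) * ‖u x‖) := by gcongr
          _ = 2 * (‖m x‖ * ‖u x‖) := by field_simp
      rw [norm_mul (m x)]
      change ‖f h x‖ + _ ≤ _
      linarith
    · filter_upwards [hv] with x hx
      rw [hx]
      exact hlim x
  · intro h
    obtain ⟨ns, hns, hae⟩ := (tendstoInMeasure_of_tendsto_Lp h).exists_seq_tendsto_ae'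
    have hF' : ∀ᶠ i in atTop, (((ns i : ℂ)⁻¹) • (expMul hm hre (ns i) u - u) : L2R)
        =ᵐ[volume] f (ns i) := hns.eventually hF
    obtain ⟨N, hN⟩ := eventually_atTop.1 hF'
    have hall : ∀ᵐ x, ∀ i, N ≤ i →
        (((ns i : ℂ)⁻¹) • (expMul hm hre (ns i) u - u) : L2R) x = f (ns i) x := by
      rw [ae_all_iff]
      intro i
      by_cases hi : N ≤ i
      · filter_upwards [hN i hi] with x hx _ using hx
      · exact ae_of_all _ fun x h => absurd h hi
    filter_upwards [hae, hall] with x h1 h2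
    refine tendsto_nhds_unique h1 (((hlim x).comp hns).congr' ?_)
    filter_upwards [eventually_ge_atTop N] with i hi
    exact (h2 i hi).symm

/-- The Fourier transform on `L²(ℝ)`. -/
abbrev fourierL2 : L2R ≃ₗᵢ[ℂ] L2R := Lp.fourierTransformₗᵢ ℝ ℂ

theorem mem_graph_fourierMulOp (u v : L2R) :
    (u, v) ∈ (fourierMulOp m).graph ↔ (fourierL2 u, fourierL2 v) ∈ (mulOp m).graph := by
  rw [LinearPMap.mem_graph_iff, LinearPMap.mem_graph_iff]
  constructor
  · rintro ⟨y, rfl, rfl⟩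
    refine ⟨⟨fourierL2 y, y.2⟩, rfl, ?_⟩
    exact (fourierL2.apply_symm_apply _).symm
  · rintro ⟨y, h1, h2⟩
    dsimp only at h1 h2
    have hy : fourierL2 u ∈ (mulOp m).domain := h1 ▸ y.2
    refine ⟨⟨u, hy⟩, rfl, ?_⟩
    have h3 : mulOp m ⟨fourierL2 u, hy⟩ = fourierL2 v := by
      rw [← h2]
      congr 1
      exact Subtype.ext h1.symm
    exact (congrArg fourierL2.symm h3).trans (fourierL2.symm_apply_apply v)

/-- The semigroup of Fourier multipliers `exp (t m)`. -/
def fourierExpMul (t : ℝ) : L2R →L[ℂ] L2R :=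
  (fourierL2.symm.toContinuousLinearEquiv : L2R →L[ℂ] L2R) ∘L expMul hm hre t ∘L
    (fourierL2.toContinuousLinearEquiv : L2R →L[ℂ] L2R)

theorem fourierExpMul_apply (t : ℝ) (u : L2R) :
    fourierExpMul hm hre t u = fourierL2.symm (expMul hm hre t (fourierL2 u)) := rfl

theorem isContractionFamily_fourierExpMul : IsContractionFamily (fourierExpMul hm hre) where
  map_zero := by
    ext1 u
    rw [fourierExpMul_apply, (isContractionFamily_expMul hm hre).map_zero]
    exact fourierL2.symm_apply_apply u
  map_add s t hs ht := by
    ext1 u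
    rw [ContinuousLinearMap.comp_apply, fourierExpMul_apply, fourierExpMul_apply,
      fourierExpMul_apply, (isContractionFamily_expMul hm hre).map_add s t hs ht,
      LinearIsometryEquiv.apply_symm_apply]
    rfl
  continuous u := fourierL2.symm.continuous.comp
    ((isContractionFamily_expMul hm hre).continuous (fourierL2 u))
  norm_le t u := by
    rw [fourierExpMul_apply, LinearIsometryEquiv.norm_map]
    exact ((isContractionFamily_expMul hm hre).norm_le t _).trans_eq (fourierL2.norm_map u)

theorem isGenerator_fourierExpMul : IsGenerator (fourierMulOp m) (fourierExpMul hm hre) := by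
  intro u v
  rw [mem_graph_fourierMulOp, isGenerator_expMul hm hre,
    fourierL2.toHomeomorph.isEmbedding.tendsto_nhds_iff
      (f := fun h : ℝ => ((h : ℂ)⁻¹) • (fourierExpMul hm hre h u - u))]
  refine tendsto_congr fun h => ?_
  change _ = fourierL2 (((h : ℂ)⁻¹) • (fourierExpMul hm hre h u - u))
  rw [map_smul, map_sub, fourierExpMul_apply, LinearIsometryEquiv.apply_symm_apply]

end Multiplication

/-! ### Fourier multipliers acting on Fourier transforms of measures -/

section FourierMultiplier

theorem Polynomial.norm_eval_ofReal_le (P : Polynomial ℂ) :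
    ∃ C : ℝ, ∀ x : ℝ, ‖P.eval (x : ℂ)‖ ≤ C * (1 + ‖x‖) ^ P.natDegree := by
  refine ⟨∑ i ∈ Finset.range (P.natDegree + 1), ‖P.coeff i‖, fun x => ?_⟩
  rw [Polynomial.eval_eq_sum_range, Finset.sum_mul]
  refine (norm_sum_le _ _).trans (Finset.sum_le_sum fun i hi => ?_)
  rw [norm_mul, norm_pow, Complex.norm_real]
  have h1 : i ≤ P.natDegree := Nat.lt_succ_iff.1 (Finset.mem_range.1 hi)
  have h2 : ‖x‖ ^ i ≤ (1 + ‖x‖) ^ i :=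
    pow_le_pow_left₀ (norm_nonneg _) (by linarith [norm_nonneg x]) _
  have h3 : (1 + ‖x‖) ^ i ≤ (1 + ‖x‖) ^ P.natDegree :=
    pow_le_pow_right₀ (by linarith [norm_nonneg x]) h1
  exact mul_le_mul_of_nonneg_left (h2.trans h3) (norm_nonneg _)

/-- Every derivative is a polynomial times the same exponential, whose modulus is at most `1`.
Multiplication by the symbol of the free semigroup therefore preserves Schwartz functions. -/
theorem hasTemperateGrowth_exp_polynomial (Q : Polynomial ℂ)
    (hQ : ∀ x : ℝ, (Q.eval (x : ℂ)).re ≤ 0) :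
    Function.HasTemperateGrowth fun x : ℝ => Complex.exp (Q.eval (x : ℂ)) := by
  have hpoly : ∀ P : Polynomial ℂ, ContDiff ℝ ((⊤ : ℕ∞) : WithTop ℕ∞) fun x : ℝ => P.eval (x : ℂ) := fun P => by
    simp only [Polynomial.eval_eq_sum_range]
    exact ContDiff.sum fun i _ => contDiff_const.mul (Complex.ofRealCLM.contDiff.pow i)
  have hderiv : ∀ (P : Polynomial ℂ) (x : ℝ),
      HasDerivAt (fun x : ℝ => P.eval (x : ℂ)) (P.derivative.eval (x : ℂ)) x := fun P x =>
    (P.hasDerivAt (x : ℂ)).comp_ofReal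
  refine ⟨(hpoly Q).cexp, fun n => ?_⟩
  have key : ∃ P : Polynomial ℂ, iteratedDeriv n (fun x : ℝ => Complex.exp (Q.eval (x : ℂ))) =
      fun x : ℝ => P.eval (x : ℂ) * Complex.exp (Q.eval (x : ℂ)) := by
    induction n with
    | zero => exact ⟨1, by simp⟩
    | succ n ih =>
      obtain ⟨P, hP⟩ := ih
      refine ⟨P.derivative + P * Q.derivative, ?_⟩
      rw [iteratedDeriv_succ, hP]
      funext x
      rw [((hderiv P x).fun_mul (hderiv Q x).cexp).deriv]
      simp only [Polynomial.eval_add, Polynomial.eval_mul]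
      ring
  obtain ⟨P, hP⟩ := key
  obtain ⟨C, hC⟩ := P.norm_eval_ofReal_le
  refine ⟨P.natDegree, C, fun x => ?_⟩
  rw [norm_iteratedFDeriv_eq_norm_iteratedDeriv, hP, norm_mul, Complex.norm_exp]
  refine (mul_le_of_le_one_right (norm_nonneg _) ?_).trans (hC x)
  exact Real.exp_le_one_iff.2 (hQ x)

variable {Ω : Type*} [MeasurableSpace Ω] {M : Measure Ω}

/-- The function `x ↦ ∫ c exp (i x Y) dM`, a superposition of plane waves. -/
def planeWaves (M : Measure Ω) (c : Ω → ℂ) (Y : Ω → ℝ) (x : ℝ) : ℂ :=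
  ∫ ω, c ω * Complex.exp (Complex.I * ((x * Y ω : ℝ) : ℂ)) ∂M

theorem norm_exp_I_mul_ofReal (a : ℝ) : ‖Complex.exp (Complex.I * (a : ℂ))‖ = 1 := by
  rw [mul_comm, Complex.norm_exp_ofReal_mul_I]

variable {c : Ω → ℂ} {Y : Ω → ℝ}

theorem norm_planeWaves_le (x : ℝ) : ‖planeWaves M c Y x‖ ≤ ∫ ω, ‖c ω‖ ∂M := by
  refine (norm_integral_le_integral_norm _).trans_eq ?_
  simp only [norm_mul, norm_exp_I_mul_ofReal, mul_one]

theorem continuous_planeWaves (hc : Integrable c M) (hY : Measurable Y) :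
    Continuous (planeWaves M c Y) := by
  unfold planeWaves
  refine continuous_of_dominated (bound := fun ω => ‖c ω‖) (fun x => ?_)
    (fun x => ae_of_all _ fun ω => ?_) hc.norm (ae_of_all _ fun ω => by fun_prop)
  · exact hc.1.mul (by fun_prop : Measurable fun ω =>
      Complex.exp (Complex.I * ((x * Y ω : ℝ) : ℂ))).aestronglyMeasurable
  · rw [norm_mul, norm_exp_I_mul_ofReal, mul_one]

/-- Fubini makes the inner integral an inverse Fourier transform; the factor `2π` converts between
the kernels `exp (i x y)` and `exp (2πi x ξ)`. -/
theorem integral_schwartz_mul_planeWaves [SFinite M] (hc : Integrable c M) (hY : Measurable Y)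
    (χ : SchwartzMap ℝ ℂ) :
    ∫ x, χ x * planeWaves M c Y x = ∫ ω, c ω * (𝓕⁻ χ) (Y ω / (2 * Real.pi)) ∂M := by
  have hmeas : Measurable fun a : ℝ × Ω => Complex.exp (Complex.I * ((a.1 * Y a.2 : ℝ) : ℂ)) := by
    fun_prop
  have hint : Integrable (fun a : ℝ × Ω =>
      χ a.1 * (c a.2 * Complex.exp (Complex.I * ((a.1 * Y a.2 : ℝ) : ℂ)))) (volume.prod M) := by
    have h1 := (χ.integrable (μ := volume)).mul_prod hc
    refine (h1.mul_bdd (c := 1) hmeas.aestronglyMeasurable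
      (ae_of_all _ fun a => (norm_exp_I_mul_ofReal _).le)).congr (ae_of_all _ fun a => ?_)
    ring
  unfold planeWaves
  simp only [← integral_const_mul]
  rw [integral_integral_swap hint]
  congr 1
  funext ω
  rw [SchwartzMap.fourierInv_coe, Real.fourierInv_eq', ← integral_const_mul]
  congr 1
  funext x
  have : (2 * Real.pi * (inner ℝ x (Y ω / (2 * Real.pi))) : ℝ) = x * Y ω := by
    simp only [RCLike.inner_apply, conj_trivial]
    have := Real.pi_ne_zero
    field_simp
  rw [smul_eq_mul, ← this]
  push_cast
  ring_nf

variable {p : ℕ} {α : ℂ} (hα : ∀ t : ℝ, 0 ≤ t → ∀ x : ℝ, ‖Complex.exp (α * t * x ^ p)‖ ≤ 1)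

/-- The Fourier symbol of `freeOp p α`. -/
def freeSymbol (p : ℕ) (α : ℂ) (ξ : ℝ) : ℂ := α * ((2 * Real.pi * ξ : ℝ) : ℂ) ^ p

theorem measurable_freeSymbol : Measurable (freeSymbol p α) := by
  unfold freeSymbol
  fun_prop

include hα in
theorem re_freeSymbol_nonpos (ξ : ℝ) : (freeSymbol p α ξ).re ≤ 0 := by
  rw [freeSymbol, ← Complex.ofReal_pow, Complex.re_mul_ofReal]
  exact re_mul_pow_nonpos hα _

/-- The free semigroup generated by `freeOp p α`. -/
def freeSemigroup (t : ℝ) : L2R →L[ℂ] L2R :=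
  fourierExpMul (m := freeSymbol p α) measurable_freeSymbol (re_freeSymbol_nonpos hα) t

include hα in
theorem hasTemperateGrowth_exp_freeSymbol {t : ℝ} (ht : 0 ≤ t) :
    Function.HasTemperateGrowth fun ξ : ℝ => Complex.exp (t * freeSymbol p α ξ) := by
  have e : ∀ ξ : ℝ, (t : ℂ) * freeSymbol p α ξ =
      (Polynomial.C ((t : ℂ) * α * ((2 * Real.pi : ℝ) : ℂ) ^ p) * Polynomial.X ^ p).eval (ξ : ℂ) := by
    intro ξ
    rw [freeSymbol, Polynomial.eval_mul, Polynomial.eval_C, Polynomial.eval_pow, Polynomial.eval_X]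
    push_cast
    ring
  simp only [e]
  refine hasTemperateGrowth_exp_polynomial _ fun ξ => ?_
  rw [← e, Complex.re_ofReal_mul]
  exact mul_nonpos_of_nonneg_of_nonpos ht (re_freeSymbol_nonpos hα ξ)

/-- The semigroup is moved onto the test function: as tempered distributions, `L²` functions allow
both Fourier transforms and the multiplier to be transposed. -/
theorem integral_schwartz_mul_freeSemigroup {t : ℝ} (ht : 0 ≤ t) (u : L2R)
    (φ : SchwartzMap ℝ ℂ) :
    ∫ x, φ x * freeSemigroup hα t u x = ∫ x, (𝓕 (SchwartzMap.smulLeftCLM ℂ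
      (fun ξ : ℝ => Complex.exp (t * freeSymbol p α ξ)) (𝓕⁻ φ))) x * u x := by
  have hT := hasTemperateGrowth_exp_freeSymbol hα ht
  set v : L2R := expMul (m := freeSymbol p α) measurable_freeSymbol (re_freeSymbol_nonpos hα) t
    (fourierL2 u) with hv
  have h1 : (Lp.toTemperedDistribution (freeSemigroup hα t u)) φ =
      (Lp.toTemperedDistribution v) (𝓕⁻ φ) := by
    rw [← TemperedDistribution.fourierInv_apply, Lp.fourierInv_toTemperedDistribution_eq]
    rfl
  have h2 : (Lp.toTemperedDistribution v) (𝓕⁻ φ) =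
      (Lp.toTemperedDistribution (𝓕 u : L2R)) (SchwartzMap.smulLeftCLM ℂ
        (fun ξ : ℝ => Complex.exp (t * freeSymbol p α ξ)) (𝓕⁻ φ)) := by
    rw [Lp.toTemperedDistribution_apply, Lp.toTemperedDistribution_apply]
    refine integral_congr_ae ?_
    filter_upwards [coeFn_expMul (m := freeSymbol p α) measurable_freeSymbol
      (re_freeSymbol_nonpos hα) t (fourierL2 u)] with ξ hξ
    rw [hv, hξ, SchwartzMap.smulLeftCLM_apply_apply hT, max_eq_left ht]
    simp only [smul_eq_mul]
    change _ = _ * fourierL2 u ξ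
    ring
  rw [← Lp.fourier_toTemperedDistribution_eq, TemperedDistribution.fourier_apply] at h2
  have h3 := h1.trans h2
  rw [Lp.toTemperedDistribution_apply, Lp.toTemperedDistribution_apply] at h3
  simpa only [smul_eq_mul] using h3

/-- The free semigroup acts on square integrable superpositions of plane waves in the expected
way. -/
theorem freeSemigroup_planeWaves [SFinite M] (hc : Integrable c M) (hY : Measurable Y)
    (hg : MemLp (planeWaves M c Y) 2 volume) {t : ℝ} (ht : 0 ≤ t) :
    freeSemigroup hα t (hg.toLp _) =ᵐ[volume]
      planeWaves M (fun ω => c ω * Complex.exp (t * (α * (Y ω : ℂ) ^ p))) Y := by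
  have hsym : ∀ ω, freeSymbol p α (Y ω / (2 * Real.pi)) = α * (Y ω : ℂ) ^ p := fun ω => by
    have := Real.pi_ne_zero
    rw [freeSymbol, mul_div_cancel₀ _ (by positivity)]
  have hc' : Integrable (fun ω => c ω * Complex.exp (t * (α * (Y ω : ℂ) ^ p))) M := by
    refine hc.mul_bdd (c := 1) (by fun_prop : Measurable fun ω =>
      Complex.exp (t * (α * (Y ω : ℂ) ^ p))).aestronglyMeasurable (ae_of_all _ fun ω => ?_)
    rw [← hsym]
    exact norm_exp_mul_le_one (re_freeSymbol_nonpos hα _) ht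
  -- The multiplier cannot be applied to the individual plane waves, which are not in `L²`. Both
  -- sides are locally integrable, so it is enough to compare them against compactly supported
  -- smooth functions.
  refine ae_eq_of_integral_contDiff_smul_eq ((Lp.memLp _).locallyIntegrable (by norm_num))
    (continuous_planeWaves hc' hY).locallyIntegrable fun f hf hfc => ?_
  have hf1 : HasCompactSupport (Complex.ofRealCLM ∘ f) := hfc.comp_left rfl
  have hf2 : ContDiff ℝ ((⊤ : ℕ∞) : WithTop ℕ∞) (Complex.ofRealCLM ∘ f) :=
    Complex.ofRealCLM.contDiff.comp hf
  set φ : SchwartzMap ℝ ℂ := hf1.toSchwartzMap hf2 with hφ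
  have hφx : ∀ x, φ x = (f x : ℂ) := fun x => rfl
  have h1 := integral_schwartz_mul_freeSemigroup hα ht (hg.toLp _) φ
  have h2 := integral_schwartz_mul_planeWaves hc' hY φ
  set ψ : SchwartzMap ℝ ℂ := SchwartzMap.smulLeftCLM ℂ
    (fun ξ : ℝ => Complex.exp (t * freeSymbol p α ξ)) (𝓕⁻ φ) with hψ
  have h3 : ∫ x, (𝓕 ψ) x * (hg.toLp (planeWaves M c Y)) x = ∫ x, (𝓕 ψ) x * planeWaves M c Y x := by
    refine integral_congr_ae ?_
    filter_upwards [hg.coeFn_toLp] with x hx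
    rw [hx]
  -- The two Fourier transforms cancel, leaving `ψ` at the frequency `Y ω / 2π`. There it is the
  -- factor `exp (t α Y^p)` times the inverse transform of `φ`.
  rw [h3, integral_schwartz_mul_planeWaves hc hY, FourierTransform.fourierInv_fourier_eq] at h1
  simp only [Complex.real_smul, ← hφx]
  rw [h1, h2]
  congr 1
  funext ω
  rw [hψ, SchwartzMap.smulLeftCLM_apply_apply (hasTemperateGrowth_exp_freeSymbol hα ht), hsym,
    smul_eq_mul, mul_assoc]

end FourierMultiplier

/-! ### Pointwise evaluation of Bochner integrals in `L²` -/

section BochnerPointwise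

/-- The Bochner integral of a continuous curve in `L²` can be computed pointwise. -/
theorem coeFn_intervalIntegral_L2 {t : ℝ} (ht : 0 ≤ t) {Φ : ℝ → L2R}
    (hΦ : IntervalIntegrable Φ volume 0 t) {G : ℝ → ℝ → ℂ} (hG : Measurable (Function.uncurry G))
    {C : ℝ} (hC : ∀ r ∈ Icc 0 t, ∀ x, ‖G r x‖ ≤ C) (h : ∀ r ∈ Icc 0 t, Φ r =ᵐ[volume] G r) :
    (∫ r in (0 : ℝ)..t, Φ r : L2R) =ᵐ[volume] fun x => ∫ r in (0 : ℝ)..t, G r x := by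
  have hGs : StronglyMeasurable (Function.uncurry G) := hG.stronglyMeasurable
  have hsm : StronglyMeasurable fun x => ∫ r in (0 : ℝ)..t, G r x := by
    simp only [intervalIntegral.integral_of_le ht]
    exact StronglyMeasurable.integral_prod_left
      (f := fun r x => G r x) hGs
  have hbound : ∀ x, ‖∫ r in (0 : ℝ)..t, G r x‖ ≤ C * |t - 0| := fun x =>
    intervalIntegral.norm_integral_le_of_norm_le_const fun r hr => by
      rw [uIoc_of_le ht] at hr
      exact hC r ⟨hr.1.le, hr.2⟩ x
  have hfin : ∀ s : Set ℝ, volume s < ⊤ → IsFiniteMeasure (volume.restrict s) := fun s hs =>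
    ⟨by simpa using hs⟩
  refine ae_eq_of_forall_setIntegral_eq_of_sigmaFinite (fun s hs hμ => ?_) (fun s hs hμ => ?_)
    fun s hs hμ => ?_
  · exact integrableOn_Lp_of_measure_ne_top _ (by norm_num) hμ.ne
  · have := hfin s hμ
    exact Integrable.of_bound hsm.aestronglyMeasurable _ (ae_of_all _ hbound)
  have := hfin s hμ
  -- Integration over a set of finite measure is a continuous functional on `L²`, so it commutes
  -- with the Bochner integral; Fubini then gives the integral of the pointwise formula.
  rw [← L2.inner_indicatorConstLp_one (𝕜 := ℂ) hs hμ.ne, ← innerSL_apply_apply (𝕜 := ℂ),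
    ← ContinuousLinearMap.intervalIntegral_comp_comm _ hΦ]
  have hint : Integrable (Function.uncurry G)
      ((volume.restrict (Ioc 0 t)).prod (volume.restrict s)) :=
    Integrable.of_bound hGs.aestronglyMeasurable C (by
      rw [Measure.prod_restrict]
      filter_upwards [ae_restrict_mem (measurableSet_Ioc.prod hs)] with a ha
      exact hC a.1 ⟨ha.1.1.le, ha.1.2⟩ a.2)
  simp only [intervalIntegral.integral_of_le ht]
  rw [integral_integral_swap (f := fun x r => G r x) hint.swap]
  refine setIntegral_congr_fun measurableSet_Ioc fun r hr => ?_
  rw [innerSL_apply_apply, L2.inner_indicatorConstLp_one]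
  exact integral_congr_ae (ae_restrict_of_ae (h r ⟨hr.1.le, hr.2⟩))

end BochnerPointwise

/-! ### Integrals over simplices -/

section Simplex

theorem measurePreserving_snoc (n : ℕ) (m : Measure ℝ) [SigmaFinite m] :
    MeasurePreserving (fun z : (Fin n → ℝ) × ℝ => (Fin.snoc z.1 z.2 : Fin (n + 1) → ℝ))
      ((Measure.pi fun _ : Fin n => m).prod m) (Measure.pi fun _ : Fin (n + 1) => m) := by
  have h := ((measurePreserving_piFinSuccAbove (fun _ : Fin (n + 1) => m) (Fin.last n)).symm).comp
    (Measure.measurePreserving_swap (μ := Measure.pi fun _ : Fin n => m) (ν := m))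
  convert h using 1
  funext z
  exact (Fin.insertNth_last' z.2 z.1).symm

theorem measurable_snoc (n : ℕ) :
    Measurable fun z : (Fin n → ℝ) × ℝ => (Fin.snoc z.1 z.2 : Fin (n + 1) → ℝ) :=
  (measurePreserving_snoc n volume).measurable

theorem isClosed_timeSimplex (n : ℕ) (t : ℝ≥0) : IsClosed (timeSimplex n t) := by
  have h : timeSimplex n t = (⋂ i, (fun s : Fin n → ℝ => s i) ⁻¹' Icc 0 (t : ℝ)) ∩
      ⋂ i, ⋂ j, ⋂ (_ : i ≤ j), {s : Fin n → ℝ | s i ≤ s j} := by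
    ext s
    simp [timeSimplex, Monotone]
  rw [h]
  refine (isClosed_iInter fun i => isClosed_Icc.preimage (by fun_prop)).inter
    (isClosed_iInter fun i => isClosed_iInter fun j => isClosed_iInter fun _ =>
      isClosed_le (by fun_prop) (by fun_prop))

theorem measurableSet_timeSimplex (n : ℕ) (t : ℝ≥0) : MeasurableSet (timeSimplex n t) :=
  (isClosed_timeSimplex n t).measurableSet

theorem timeSimplex_mono (n : ℕ) {r t : ℝ≥0} (h : r ≤ t) : timeSimplex n r ⊆ timeSimplex n t :=
  fun _ hs => ⟨fun i => ⟨(hs.1 i).1, (hs.1 i).2.trans h⟩, hs.2⟩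

theorem timeSimplex_subset_Icc (n : ℕ) (t : ℝ≥0) :
    timeSimplex n t ⊆ Icc (fun _ => 0) fun _ => (t : ℝ) :=
  fun _ hs => ⟨fun i => (hs.1 i).1, fun i => (hs.1 i).2⟩

theorem volume_timeSimplex_lt_top (n : ℕ) (t : ℝ≥0) : volume (timeSimplex n t) < ⊤ :=
  (measure_mono (timeSimplex_subset_Icc n t)).trans_lt isCompact_Icc.measure_lt_top

instance isFiniteMeasure_restrict_timeSimplex (n : ℕ) (t : ℝ≥0) :
    IsFiniteMeasure ((volume : Measure (Fin n → ℝ)).restrict (timeSimplex n t)) :=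
  ⟨by simpa using volume_timeSimplex_lt_top n t⟩

/-- The last time is the largest, so fixing it at `r` leaves a simplex over `[0, r]`. -/
theorem snoc_mem_timeSimplex {n : ℕ} {t : ℝ≥0} {s : Fin n → ℝ} {r : ℝ≥0} :
    (Fin.snoc s (r : ℝ) : Fin (n + 1) → ℝ) ∈ timeSimplex (n + 1) t ↔
      r ≤ t ∧ s ∈ timeSimplex n r := by
  simp only [timeSimplex, mem_ofPred_eq, Fin.forall_fin_succ', Fin.snoc_castSucc, Fin.snoc_last]
  constructor
  · rintro ⟨⟨h1, h2⟩, h3⟩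
    refine ⟨by exact_mod_cast h2.2, fun i => ⟨(h1 i).1, ?_⟩, fun i j hij => ?_⟩
    · simpa using h3 (Fin.le_last i.castSucc)
    · simpa using h3 (Fin.castSucc_le_castSucc_iff.2 hij)
  · rintro ⟨h1, h2, h3⟩
    have h1' : (r : ℝ) ≤ t := by exact_mod_cast h1
    refine ⟨⟨fun i => ⟨(h2 i).1, (h2 i).2.trans h1'⟩, r.2, h1'⟩, ?_⟩
    intro i j
    refine Fin.lastCases ?_ (fun i => ?_) i <;> refine Fin.lastCases ?_ (fun j => ?_) j
    · simp
    · intro h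
      exact absurd h (not_le.2 (Fin.castSucc_lt_last j))
    · intro _
      simpa using (h2 i).2
    · intro h
      simpa using h3 (Fin.castSucc_le_castSucc_iff.1 h)

/-- The integral over the first variables of a function on a simplex, for a fixed last variable. -/
def timeSlice (n : ℕ) (t : ℝ≥0) (F : (Fin (n + 1) → ℝ) → ℂ) (r : ℝ) : ℂ :=
  ∫ s, (timeSimplex (n + 1) t).indicator F (Fin.snoc s r)

theorem timeSlice_eq (n : ℕ) {t : ℝ≥0} (F : (Fin (n + 1) → ℝ) → ℂ) {r : ℝ≥0} (hr : r ≤ t) :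
    timeSlice n t F r = ∫ s in timeSimplex n r, F (Fin.snoc s (r : ℝ)) := by
  rw [timeSlice, ← integral_indicator (measurableSet_timeSimplex n r)]
  congr 1
  funext s
  by_cases hs : s ∈ timeSimplex n r
  · rw [indicator_of_mem hs, indicator_of_mem (snoc_mem_timeSimplex.2 ⟨hr, hs⟩)]
  · rw [indicator_of_notMem hs, indicator_of_notMem fun h => hs (snoc_mem_timeSimplex.1 h).2]

/-- Fubini with the largest time outermost, the order of integration in Duhamel's formula. -/
theorem setIntegral_timeSimplex_succ (n : ℕ) (t : ℝ≥0) {F : (Fin (n + 1) → ℝ) → ℂ}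
    (hF : IntegrableOn F (timeSimplex (n + 1) t)) :
    ∫ s in timeSimplex (n + 1) t, F s = ∫ r in (0 : ℝ)..t, timeSlice n t F r := by
  have hmp := measurePreserving_snoc n volume
  have hF' := (integrable_indicator_iff (measurableSet_timeSimplex (n + 1) t)).2 hF
  rw [← integral_indicator (measurableSet_timeSimplex (n + 1) t)]
  change ∫ s, _ ∂(Measure.pi fun _ : Fin (n + 1) => volume) = _
  have hF2 : Integrable ((timeSimplex (n + 1) t).indicator F)
    (Measure.pi fun _ : Fin (n + 1) => volume) := hF'
  have hF3 : Integrable (fun z : (Fin n → ℝ) × ℝ =>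
      (timeSimplex (n + 1) t).indicator F (Fin.snoc z.1 z.2))
      ((Measure.pi fun _ : Fin n => volume).prod volume) :=
    hmp.integrable_comp_of_integrable hF2
  rw [← hmp.map_eq, integral_map hmp.measurable.aemeasurable (by rw [hmp.map_eq]; exact hF2.1),
    integral_prod_symm _ hF3, intervalIntegral.integral_of_le t.coe_nonneg, ← integral_Icc_eq_integral_Ioc,
    ← integral_indicator measurableSet_Icc]
  congr 1
  funext r
  by_cases hr : r ∈ Icc (0 : ℝ) t
  · rw [indicator_of_mem hr]
    rfl
  · rw [indicator_of_notMem hr]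
    refine integral_eq_zero_of_ae (ae_of_all _ fun s => indicator_of_notMem (fun h => hr ?_) _)
    simpa using h.1 (Fin.last n)

theorem norm_timeSlice_le (n : ℕ) (t : ℝ≥0) {F : (Fin (n + 1) → ℝ) → ℂ} {C : ℝ}
    (hC : ∀ s, ‖F s‖ ≤ C) {r : ℝ} (hr : r ∈ Icc (0 : ℝ) t) :
    ‖timeSlice n t F r‖ ≤ C * volume.real (timeSimplex n t) := by
  lift r to ℝ≥0 using hr.1
  have hr' : r ≤ t := by exact_mod_cast hr.2
  have hC0 : 0 ≤ C := (norm_nonneg _).trans (hC 0)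
  rw [timeSlice_eq n F hr']
  refine (norm_setIntegral_le_of_norm_le_const (volume_timeSimplex_lt_top n r)
    fun s _ => hC _).trans ?_
  exact mul_le_mul_of_nonneg_left (measureReal_mono (timeSimplex_mono n hr')
    (volume_timeSimplex_lt_top n t).ne) hC0

theorem measurable_timeSlice {X : Type*} [MeasurableSpace X] (n : ℕ) (t : ℝ≥0)
    {F : X → (Fin (n + 1) → ℝ) → ℂ} (hF : Measurable (Function.uncurry F)) :
    Measurable fun a : ℝ × X => timeSlice n t (F a.2) a.1 := by
  have h : Measurable fun b : (ℝ × X) × (Fin n → ℝ) =>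
      (timeSimplex (n + 1) t).indicator (F b.1.2) (Fin.snoc b.2 b.1.1) := by
    have e : (fun b : (ℝ × X) × (Fin n → ℝ) =>
        (timeSimplex (n + 1) t).indicator (F b.1.2) (Fin.snoc b.2 b.1.1)) =
        ((Prod.snd ⁻¹' timeSimplex (n + 1) t).indicator (Function.uncurry F)) ∘
          fun b : (ℝ × X) × (Fin n → ℝ) => (b.1.2, (Fin.snoc b.2 b.1.1 : Fin (n + 1) → ℝ)) := rfl
    rw [e]
    refine (hF.indicator (measurable_snd (measurableSet_timeSimplex (n + 1) t))).comp ?_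
    exact (measurable_snd.comp measurable_fst).prodMk
      ((measurable_snoc n).comp (measurable_snd.prodMk (measurable_fst.comp measurable_fst)))
  exact (StronglyMeasurable.integral_prod_right (f := fun (a : ℝ × X) (s : Fin n → ℝ) =>
    (timeSimplex (n + 1) t).indicator (F a.2) (Fin.snoc s a.1)) h.stronglyMeasurable).measurable

theorem timeSimplex_zero (t : ℝ≥0) : timeSimplex 0 t = univ :=
  eq_univ_of_forall fun _ => ⟨fun i => i.elim0, fun i => i.elim0⟩

theorem setIntegral_timeSimplex_zero (t : ℝ≥0) (F : (Fin 0 → ℝ) → ℂ) :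
    ∫ s in timeSimplex 0 t, F s = F default := by
  rw [timeSimplex_zero, Measure.restrict_univ, integral_unique]
  simp [measureReal_def, volume_pi]
  congr 1
  exact Subsingleton.elim _ _

theorem integrableOn_timeSimplex (n : ℕ) (t : ℝ≥0) {F : (Fin n → ℝ) → ℂ} (hF : Measurable F)
    {C : ℝ} (hC : ∀ s, ‖F s‖ ≤ C) : IntegrableOn F (timeSimplex n t) :=
  Integrable.of_bound hF.aestronglyMeasurable C (ae_of_all _ hC)

/-- With `G` the primitive of `g`, the slice at `r` is `G^n / n! · g` by induction. This is the
derivative of `G^(n+1) / (n+1)!`, so no symmetrization over permutations is needed. -/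
theorem setIntegral_timeSimplex_prod (n : ℕ) (t : ℝ≥0) {g : ℝ → ℂ} (hg : Continuous g) :
    ∫ s in timeSimplex n t, ∏ i, g (s i) = (∫ r in (0 : ℝ)..t, g r) ^ n / n.factorial := by
  induction n generalizing t with
  | zero =>
    rw [setIntegral_timeSimplex_zero]
    simp
  | succ n ih =>
    have hcont : Continuous fun s : Fin (n + 1) → ℝ => ∏ i, g (s i) := by fun_prop
    rw [setIntegral_timeSimplex_succ n t (hcont.continuousOn.integrableOn_compact
      (isCompact_Icc.of_isClosed_subset (isClosed_timeSimplex _ _) (timeSimplex_subset_Icc _ _)))]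
    have h1 : ∀ r ∈ uIcc (0 : ℝ) t, timeSlice n t (fun s => ∏ i, g (s i)) r =
        (∫ u in (0 : ℝ)..r, g u) ^ n / n.factorial * g r := by
      intro r hr
      rw [uIcc_of_le t.coe_nonneg] at hr
      lift r to ℝ≥0 using hr.1
      rw [timeSlice_eq n _ (by exact_mod_cast hr.2), ← ih r, ← integral_mul_const]
      simp only [Fin.prod_univ_castSucc, Fin.snoc_castSucc, Fin.snoc_last]
    rw [intervalIntegral.integral_congr h1]
    have hprim : ∀ r : ℝ, HasDerivAt (fun r : ℝ => ∫ u in (0 : ℝ)..r, g u) (g r) r := fun r =>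
      intervalIntegral.integral_hasDerivAt_right (hg.intervalIntegrable _ _)
        (hg.stronglyMeasurableAtFilter _ _) hg.continuousAt
    have hder : ∀ r ∈ uIcc (0 : ℝ) t, HasDerivAt
        (fun r : ℝ => (∫ u in (0 : ℝ)..r, g u) ^ (n + 1) / (n + 1).factorial)
        ((∫ u in (0 : ℝ)..r, g u) ^ n / n.factorial * g r) r := by
      intro r _
      refine (((hprim r).fun_pow (n + 1)).div_const _).congr_deriv ?_
      have h1 : ((n : ℂ) + 1) ≠ 0 := by exact_mod_cast n.succ_ne_zero
      have h2 : (n.factorial : ℂ) ≠ 0 := by exact_mod_cast n.factorial_ne_zero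
      rw [Nat.factorial_succ]
      push_cast
      field_simp
    have hprimc : Continuous fun r : ℝ => ∫ u in (0 : ℝ)..r, g u :=
      continuous_iff_continuousAt.2 fun r => (hprim r).continuousAt
    rw [intervalIntegral.integral_eq_sub_of_hasDerivAt hder
      ((((hprimc.pow n).div_const _).mul hg).intervalIntegrable 0 (t : ℝ))]
    simp

theorem volume_real_timeSimplex (n : ℕ) (t : ℝ≥0) :
    volume.real (timeSimplex n t) = (t : ℝ) ^ n / n.factorial := by
  have h := setIntegral_timeSimplex_prod n t (g := fun _ => 1) continuous_const
  simp at h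
  exact_mod_cast h

end Simplex

/-! ### The Dyson series of a superposition of plane waves -/

section PlaneWaves

variable {Ω Ω' : Type*} [MeasurableSpace Ω] [MeasurableSpace Ω'] {M : Measure Ω} {N : Measure Ω'}

/-- Frequencies add under multiplication; this is how a factor `V` acts in the Dyson series. -/
theorem planeWaves_mul [SFinite M] [SFinite N] (c : Ω → ℂ) (Y : Ω → ℝ) (c' : Ω' → ℂ)
    (Y' : Ω' → ℝ) (x : ℝ) :
    planeWaves M c Y x * planeWaves N c' Y' x =
      planeWaves (M.prod N) (fun z => c z.1 * c' z.2) (fun z => Y z.1 + Y' z.2) x := by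
  unfold planeWaves
  rw [← integral_prod_mul]
  congr 1
  funext z
  rw [mul_add, Complex.ofReal_add, mul_add, Complex.exp_add]
  ring

theorem planeWaves_prod [SFinite M] [SFinite N] {c : Ω × Ω' → ℂ} (hc : Integrable c (M.prod N))
    {Y : Ω × Ω' → ℝ} (hY : Measurable Y) (x : ℝ) :
    planeWaves (M.prod N) c Y x =
      ∫ ω, planeWaves N (fun ω' => c (ω, ω')) (fun ω' => Y (ω, ω')) x ∂M := by
  unfold planeWaves
  rw [integral_prod]
  exact hc.mul_bdd (c := 1) (by fun_prop : Measurable fun ω =>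
    Complex.exp (Complex.I * ((x * Y ω : ℝ) : ℂ))).aestronglyMeasurable
    (ae_of_all _ fun ω => (norm_exp_I_mul_ofReal _).le)

theorem planeWaves_comp {φ : Ω → Ω'} (hφ : MeasurePreserving φ M N) {c : Ω' → ℂ}
    (hc : Measurable c) {Y : Ω' → ℝ} (hY : Measurable Y) (x : ℝ) :
    planeWaves M (fun ω => c (φ ω)) (fun ω => Y (φ ω)) x = planeWaves N c Y x := by
  unfold planeWaves
  rw [← hφ.map_eq, integral_map hφ.measurable.aemeasurable]
  exact (by fun_prop : Measurable fun ω =>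
    c ω * Complex.exp (Complex.I * ((x * Y ω : ℝ) : ℂ))).aestronglyMeasurable

end PlaneWaves

/-! ### Path amplitudes and their identification with Dyson terms -/

section Amplitude

variable (p : ℕ) [Fact (2 ≤ p)] (α : ℂ) (m₀ m : Measure ℝ) (c₀ c : ℝ → ℂ)

/-- The measure on the frequencies `(y₀, y₁, …, yₙ)`. -/
def freqMeasure (n : ℕ) : Measure (ℝ × (Fin n → ℝ)) := m₀.prod (Measure.pi fun _ => m)

/-- The density of the complex measure on the frequencies `(y₀, y₁, …, yₙ)`. -/
def freqWeight {n : ℕ} (a : ℝ × (Fin n → ℝ)) : ℂ := c₀ a.1 * ∏ i, c (a.2 i)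

/-- The total frequency `y₀ + y₁ + ⋯ + yₙ`. -/
def freqSum {n : ℕ} (a : ℝ × (Fin n → ℝ)) : ℝ := a.1 + ∑ i, a.2 i

/-- The value `∫ exp (i x (y₀ + ⋯ + yₙ)) exp (Φ(γ)) dμ₀(y₀) dμ(y₁) ⋯ dμ(yₙ)`, where `γ` is the path
determined by the times `s` and the frequencies. -/
def pathAmplitude {n : ℕ} (t : ℝ≥0) (x : ℝ) (s : Fin n → ℝ) : ℂ :=
  planeWaves (freqMeasure m₀ m n)
    (fun a => freqWeight c₀ c a * Complex.exp (pathPhase p α (rampSum p t s a.1 a.2))) freqSum x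

variable {p α m₀ m c₀ c}

theorem measurable_freqSum {n : ℕ} : Measurable (freqSum : ℝ × (Fin n → ℝ) → ℝ) := by
  unfold freqSum
  fun_prop

theorem measurable_freqWeight (hc₀ : Measurable c₀) (hc : Measurable c) {n : ℕ} :
    Measurable (freqWeight c₀ c (n := n)) := by
  unfold freqWeight
  fun_prop

theorem measurable_exp_pathPhase_rampSum (t : ℝ≥0) (n : ℕ) :
    Measurable fun b : (Fin n → ℝ) × ℝ × (Fin n → ℝ) =>
      Complex.exp (pathPhase p α (rampSum p t b.1 b.2.1 b.2.2)) :=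
  (Complex.continuous_exp.comp ((continuous_pathPhase p α).comp
    (continuous_rampSum (ENNReal.natCast_ne_top p) n))).measurable

variable [IsFiniteMeasure m₀] [IsFiniteMeasure m]

set_option linter.unusedSectionVars false

instance isFiniteMeasure_freqMeasure (n : ℕ) : IsFiniteMeasure (freqMeasure m₀ m n) := by
  unfold freqMeasure
  infer_instance

theorem integrable_freqWeight (hc₀ : Integrable c₀ m₀) (hc : Integrable c m) (n : ℕ) :
    Integrable (freqWeight c₀ c) (freqMeasure m₀ m n) :=
  hc₀.mul_prod (Integrable.fintype_prod fun _ => hc)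

theorem integral_norm_freqWeight (n : ℕ) :
    ∫ a, ‖freqWeight c₀ c a‖ ∂(freqMeasure m₀ m n) = (∫ y, ‖c₀ y‖ ∂m₀) * (∫ y, ‖c y‖ ∂m) ^ n := by
  simp only [freqWeight, norm_mul, norm_prod, freqMeasure]
  rw [integral_prod_mul (fun y => ‖c₀ y‖) (fun y : Fin n → ℝ => ∏ i, ‖c (y i)‖),
    integral_fintype_prod_eq_prod (fun _ y => ‖c y‖)]
  simp

theorem integral_freqWeight_mul_exp (n : ℕ) (z₀ : ℝ) (z : Fin n → ℝ) :
    ∫ a, freqWeight c₀ c a * Complex.exp (Complex.I * ((z₀ * a.1 + ∑ i, z i * a.2 i : ℝ) : ℂ))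
      ∂(freqMeasure m₀ m n) = planeWaves m₀ c₀ id z₀ * ∏ i, planeWaves m c id (z i) := by
  unfold planeWaves
  have e : ∀ a : ℝ × (Fin n → ℝ), freqWeight c₀ c a *
      Complex.exp (Complex.I * ((z₀ * a.1 + ∑ i, z i * a.2 i : ℝ) : ℂ)) =
      (c₀ a.1 * Complex.exp (Complex.I * ((z₀ * a.1 : ℝ) : ℂ))) *
      ∏ i, (c (a.2 i) * Complex.exp (Complex.I * ((z i * a.2 i : ℝ) : ℂ))) := by
    intro a
    rw [Finset.prod_mul_distrib, ← Complex.exp_sum, ← Finset.mul_sum, ← Complex.ofReal_sum,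
      Complex.ofReal_add, mul_add, Complex.exp_add, freqWeight]
    ring
  simp only [e, freqMeasure]
  rw [integral_prod_mul (fun y => c₀ y * Complex.exp (Complex.I * ((z₀ * y : ℝ) : ℂ)))
    (fun y : Fin n → ℝ => ∏ i, (c (y i) * Complex.exp (Complex.I * ((z i * y i : ℝ) : ℂ)))),
    integral_fintype_prod_eq_prod fun i y => c y * Complex.exp (Complex.I * ((z i * y : ℝ) : ℂ))]
  rfl

theorem planeWaves_freqMeasure (n : ℕ) (x : ℝ) :
    planeWaves (freqMeasure m₀ m n) (freqWeight c₀ c) freqSum x =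
      planeWaves m₀ c₀ id x * planeWaves m c id x ^ n := by
  have h := integral_freqWeight_mul_exp (m₀ := m₀) (m := m) (c₀ := c₀) (c := c) n x fun _ => x
  simp only [← Finset.mul_sum, ← mul_add, Finset.prod_const, Finset.card_univ,
    Fintype.card_fin] at h
  exact h

variable (hα : ∀ t : ℝ, 0 ≤ t → ∀ x : ℝ, ‖Complex.exp (α * t * x ^ p)‖ ≤ 1)
  (hc₀ : Measurable c₀) (hc : Measurable c) (hi₀ : Integrable c₀ m₀) (hi : Integrable c m)

include hα in
theorem norm_pathAmplitude_le {n : ℕ} (t : ℝ≥0) (x : ℝ) (s : Fin n → ℝ) (hi₀ : Integrable c₀ m₀)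
    (hi : Integrable c m) :
    ‖pathAmplitude p α m₀ m c₀ c t x s‖ ≤ (∫ y, ‖c₀ y‖ ∂m₀) * (∫ y, ‖c y‖ ∂m) ^ n := by
  refine (norm_planeWaves_le x).trans ?_
  rw [← integral_norm_freqWeight n]
  refine integral_mono_of_nonneg (ae_of_all _ fun _ => norm_nonneg _)
    (integrable_freqWeight hi₀ hi n).norm (ae_of_all _ fun a => ?_)
  simp only [norm_mul]
  exact mul_le_of_le_one_right (norm_nonneg _) (norm_exp_pathPhase_le p hα _)

include hc₀ hc in
theorem measurable_pathAmplitude (n : ℕ) (t : ℝ≥0) :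
    Measurable (Function.uncurry (pathAmplitude p α m₀ m c₀ c t (n := n))) := by
  have h : Measurable fun b : (ℝ × (Fin n → ℝ)) × (ℝ × (Fin n → ℝ)) =>
      freqWeight c₀ c b.2 * Complex.exp (pathPhase p α (rampSum p t b.1.2 b.2.1 b.2.2)) *
        Complex.exp (Complex.I * ((b.1.1 * freqSum b.2 : ℝ) : ℂ)) := by
    have h1 := (measurable_exp_pathPhase_rampSum (p := p) (α := α) t n).comp
      (by fun_prop : Measurable fun b : (ℝ × (Fin n → ℝ)) × (ℝ × (Fin n → ℝ)) =>
        (b.1.2, b.2.1, b.2.2))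
    refine (((measurable_freqWeight hc₀ hc).comp measurable_snd).mul h1).mul ?_
    have := measurable_freqSum (n := n)
    fun_prop
  exact (StronglyMeasurable.integral_prod_right (ν := freqMeasure m₀ m n)
    (f := fun (a : ℝ × (Fin n → ℝ)) b => freqWeight c₀ c b *
      Complex.exp (pathPhase p α (rampSum p t a.2 b.1 b.2)) *
        Complex.exp (Complex.I * ((a.1 * freqSum b : ℝ) : ℂ))) h.stronglyMeasurable).measurable

/-- Splitting off the last time. -/
theorem pathPhase_rampSum_snoc {n : ℕ} {r t : ℝ≥0} (hr : r ≤ t) {s : Fin n → ℝ}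
    (hs : s ∈ timeSimplex n r) (y₀ : ℝ) (y : Fin n → ℝ) (z : ℝ) :
    pathPhase p α (rampSum p t (Fin.snoc s (r : ℝ) : Fin (n + 1) → ℝ) y₀ (Fin.snoc y z)) =
      pathPhase p α (rampSum p r s y₀ y) +
        ((t - r : ℝ) : ℂ) * (α * ((freqSum (y₀, y) + z : ℝ) : ℂ) ^ p) := by
  have hr' : (r : ℝ) ≤ t := by exact_mod_cast hr
  -- Up to time `r` the last frequency is not yet switched on.
  have e1 : ∫ u in (0 : ℝ)..r, (y₀ + ∑ i, (Fin.snoc y z : Fin (n + 1) → ℝ) i *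
      (Ioi ((Fin.snoc s (r : ℝ) : Fin (n + 1) → ℝ) i)).indicator 1 u) ^ p =
      ∫ u in (0 : ℝ)..r, (y₀ + ∑ i, y i * (Ioi (s i)).indicator 1 u) ^ p := by
    refine intervalIntegral.integral_congr fun u hu => ?_
    rw [uIcc_of_le r.coe_nonneg] at hu
    have h0 : (Ioi (r : ℝ)).indicator (1 : ℝ → ℝ) u = 0 :=
      indicator_of_notMem (not_lt.2 hu.2) _
    simp only [Fin.sum_univ_castSucc, Fin.snoc_castSucc, Fin.snoc_last, h0, mul_zero, add_zero]
  -- After time `r` all frequencies are switched on, so the integrand is the constant `p`-th power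
  -- of the total frequency.
  have e2 : ∫ u in (r : ℝ)..t, (y₀ + ∑ i, (Fin.snoc y z : Fin (n + 1) → ℝ) i *
      (Ioi ((Fin.snoc s (r : ℝ) : Fin (n + 1) → ℝ) i)).indicator 1 u) ^ p =
      (t - r) * (freqSum (y₀, y) + z) ^ p := by
    rw [← smul_eq_mul, ← intervalIntegral.integral_const]
    refine intervalIntegral.integral_congr_ae (ae_of_all _ fun u hu => ?_)
    rw [uIoc_of_le hr'] at hu
    have h0 : (Ioi (r : ℝ)).indicator (1 : ℝ → ℝ) u = 1 := indicator_of_mem hu.1 _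
    have h1 : ∀ i, (Ioi (s i)).indicator (1 : ℝ → ℝ) u = 1 := fun i =>
      indicator_of_mem (((hs.1 i).2).trans_lt hu.1) _
    simp only [Fin.sum_univ_castSucc, Fin.snoc_castSucc, Fin.snoc_last, h0, h1, mul_one, freqSum,
      add_assoc]
  have hint : ∀ a b : ℝ, IntervalIntegrable (fun u => (y₀ + ∑ i, (Fin.snoc y z : Fin (n + 1) → ℝ) i *
      (Ioi ((Fin.snoc s (r : ℝ) : Fin (n + 1) → ℝ) i)).indicator 1 u) ^ p) volume a b := by
    intro a b
    have hm : Measurable fun u : ℝ => (y₀ + ∑ i, (Fin.snoc y z : Fin (n + 1) → ℝ) i *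
      (Ioi ((Fin.snoc s (r : ℝ) : Fin (n + 1) → ℝ) i)).indicator (1 : ℝ → ℝ) u) ^ p := by
      refine Measurable.pow_const (measurable_const.add (Finset.measurable_sum _ fun i _ =>
        measurable_const.mul (measurable_one.indicator measurableSet_Ioi))) _
    refine (intervalIntegrable_const (c := (|y₀| + ∑ i, |(Fin.snoc y z : Fin (n + 1) → ℝ) i|) ^ p)).mono_fun
      hm.aestronglyMeasurable (ae_of_all _ fun u => ?_)
    simp only [norm_pow]
    refine pow_le_pow_left₀ (norm_nonneg _) ?_ _
    refine (norm_add_le _ _).trans ((add_le_add le_rfl ((norm_sum_le _ _).trans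
      (Finset.sum_le_sum fun i _ => ?_))).trans (le_abs_self _))
    rw [norm_mul]
    refine mul_le_of_le_one_right (norm_nonneg _) ?_
    by_cases hu : u ∈ Ioi ((Fin.snoc s (r : ℝ) : Fin (n + 1) → ℝ) i) <;> simp [hu]
  rw [pathPhase_rampSum, pathPhase_rampSum, ← intervalIntegral.integral_add_adjacent_intervals
    (hint 0 r) (hint r t), e1, e2]
  push_cast
  ring

theorem measurePreserving_freq_snoc (n : ℕ) :
    MeasurePreserving (fun b : (ℝ × (Fin n → ℝ)) × ℝ =>
      (b.1.1, (Fin.snoc b.1.2 b.2 : Fin (n + 1) → ℝ)))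
      ((freqMeasure m₀ m n).prod m) (freqMeasure m₀ m (n + 1)) :=
  ((MeasurePreserving.id m₀).prod (measurePreserving_snoc n m)).comp
    (measurePreserving_prodAssoc m₀ (Measure.pi fun _ : Fin n => m) m)

theorem freqWeight_snoc {n : ℕ} (b : (ℝ × (Fin n → ℝ)) × ℝ) :
    freqWeight c₀ c (b.1.1, (Fin.snoc b.1.2 b.2 : Fin (n + 1) → ℝ)) = freqWeight c₀ c b.1 * c b.2 := by
  simp only [freqWeight, Fin.prod_univ_castSucc, Fin.snoc_castSucc, Fin.snoc_last, mul_assoc]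

theorem freqSum_snoc {n : ℕ} (b : (ℝ × (Fin n → ℝ)) × ℝ) :
    freqSum (b.1.1, (Fin.snoc b.1.2 b.2 : Fin (n + 1) → ℝ)) = freqSum b.1 + b.2 := by
  simp only [freqSum, Fin.sum_univ_castSucc, Fin.snoc_castSucc, Fin.snoc_last, add_assoc]

/-- The measure on times and frequencies of the `n`-th term of the Dyson series. -/
def dysonMeasure (m₀ m : Measure ℝ) (n : ℕ) (t : ℝ≥0) : Measure ((Fin n → ℝ) × ℝ × (Fin n → ℝ)) :=
  ((volume : Measure (Fin n → ℝ)).restrict (timeSimplex n t)).prod (freqMeasure m₀ m n)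

instance isFiniteMeasure_dysonMeasure (n : ℕ) (t : ℝ≥0) :
    IsFiniteMeasure (dysonMeasure m₀ m n t) := by
  unfold dysonMeasure
  infer_instance

theorem integrable_dysonWeight (hi₀ : Integrable c₀ m₀) (hi : Integrable c m) (n : ℕ) (t : ℝ≥0) :
    Integrable (fun b => freqWeight c₀ c b.2) (dysonMeasure m₀ m n t) :=
  (integrable_freqWeight hi₀ hi n).comp_snd _

include hα in
theorem integrable_dysonWeight_mul_exp (hi₀ : Integrable c₀ m₀) (hi : Integrable c m) (n : ℕ)
    (t r : ℝ≥0) :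
    Integrable (fun b => freqWeight c₀ c b.2 *
      Complex.exp (pathPhase p α (rampSum p t b.1 b.2.1 b.2.2))) (dysonMeasure m₀ m n r) :=
  (integrable_dysonWeight hi₀ hi n r).mul_bdd (c := 1)
    (measurable_exp_pathPhase_rampSum t n).aestronglyMeasurable
    (ae_of_all _ fun _ => norm_exp_pathPhase_le p hα _)

include hα in
-- Treating the times as parameters of the superposition, on the same footing as the frequencies,
-- makes the whole simplex integral one family of plane waves to which the free semigroup can be
-- applied.
theorem setIntegral_pathAmplitude (hi₀ : Integrable c₀ m₀) (hi : Integrable c m) (n : ℕ)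
    (t : ℝ≥0) (x : ℝ) :
    ∫ s in timeSimplex n t, pathAmplitude p α m₀ m c₀ c t x s =
      planeWaves (dysonMeasure m₀ m n t) (fun b => freqWeight c₀ c b.2 *
        Complex.exp (pathPhase p α (rampSum p t b.1 b.2.1 b.2.2))) (fun b => freqSum b.2) x :=
  (planeWaves_prod (integrable_dysonWeight_mul_exp hα hi₀ hi n t t)
    (measurable_freqSum.comp measurable_snd) x).symm

include hα in
/-- The last-time slices of the amplitude, as superpositions of plane waves. -/
theorem timeSlice_pathAmplitude (hc₀ : Measurable c₀) (hc : Measurable c)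
    (hi₀ : Integrable c₀ m₀) (hi : Integrable c m) (n : ℕ) {r t : ℝ≥0} (hr : r ≤ t) (x : ℝ) :
    timeSlice n t (pathAmplitude p α m₀ m c₀ c t x) r =
      planeWaves ((dysonMeasure m₀ m n r).prod m) (fun z => freqWeight c₀ c z.1.2 *
        Complex.exp (pathPhase p α (rampSum p r z.1.1 z.1.2.1 z.1.2.2)) * c z.2 *
        Complex.exp (((t - r : ℝ) : ℂ) * (α * ((freqSum z.1.2 + z.2 : ℝ) : ℂ) ^ p)))
        (fun z => freqSum z.1.2 + z.2) x := by
  have hfs := measurable_freqSum (n := n)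
  have hfw := measurable_freqWeight hc₀ hc (n := n)
  have hphase := measurable_exp_pathPhase_rampSum (p := p) (α := α) r n
  have hexp : Measurable fun z : ((Fin n → ℝ) × ℝ × (Fin n → ℝ)) × ℝ =>
      Complex.exp (((t - r : ℝ) : ℂ) * (α * ((freqSum z.1.2 + z.2 : ℝ) : ℂ) ^ p)) := by fun_prop
  have hbase : Measurable fun z : ((Fin n → ℝ) × ℝ × (Fin n → ℝ)) × ℝ =>
      freqWeight c₀ c z.1.2 *
        Complex.exp (pathPhase p α (rampSum p r z.1.1 z.1.2.1 z.1.2.2)) * c z.2 :=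
    ((hfw.comp (measurable_snd.comp measurable_fst)).mul (hphase.comp measurable_fst)).mul
      (hc.comp measurable_snd)
  have hint : Integrable (fun z : ((Fin n → ℝ) × ℝ × (Fin n → ℝ)) × ℝ => freqWeight c₀ c z.1.2 *
        Complex.exp (pathPhase p α (rampSum p r z.1.1 z.1.2.1 z.1.2.2)) * c z.2 *
        Complex.exp (((t - r : ℝ) : ℂ) * (α * ((freqSum z.1.2 + z.2 : ℝ) : ℂ) ^ p)))
      ((dysonMeasure m₀ m n r).prod m) := by
    refine ((integrable_dysonWeight_mul_exp hα hi₀ hi n r r).mul_prod hi).mul_bdd (c := 1)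
      hexp.aestronglyMeasurable (ae_of_all _ fun z => ?_)
    have h := hα (t - r) (sub_nonneg.2 (by exact_mod_cast hr)) (freqSum z.1.2 + z.2)
    rwa [mul_comm α, mul_assoc] at h
  have hmp := (measurePreserving_prodAssoc
    ((volume : Measure (Fin n → ℝ)).restrict (timeSimplex n r)) (freqMeasure m₀ m n) m).symm
  rw [timeSlice_eq n _ hr]
  refine Eq.trans ?_ (planeWaves_comp hmp (hbase.mul hexp) (by fun_prop) x)
  refine Eq.trans ?_ (planeWaves_prod (hmp.integrable_comp_of_integrable hint) (by fun_prop) x).symm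
  refine setIntegral_congr_fun (measurableSet_timeSimplex n r) fun s hs => ?_
  have hw := (measurable_freqWeight hc₀ hc (n := n + 1)).mul
    ((measurable_exp_pathPhase_rampSum (p := p) (α := α) t (n + 1)).comp
      (measurable_prodMk_left (x := (Fin.snoc s (r : ℝ) : Fin (n + 1) → ℝ))))
  refine (planeWaves_comp (measurePreserving_freq_snoc n) hw measurable_freqSum x).symm.trans ?_
  unfold planeWaves
  congr 1
  funext b
  simp only [Pi.mul_apply, Function.comp_apply, freqWeight_snoc, freqSum_snoc]
  rw [pathPhase_rampSum_snoc hr hs, Complex.exp_add]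
  change _ = freqWeight c₀ c b.1 * _ * c b.2 * _ * _
  simp only [MeasurableEquiv.prodAssoc, MeasurableEquiv.symm_mk, MeasurableEquiv.coe_mk,
    Equiv.prodAssoc_symm_apply]
  ring

include hα in
theorem freeSemigroup_of_ae_eq_planeWaves {Ω : Type*} [MeasurableSpace Ω] {M : Measure Ω}
    [SFinite M] {b : Ω → ℂ} {Y : Ω → ℝ} (hb : Integrable b M) (hY : Measurable Y) {u : L2R}
    (hu : u =ᵐ[volume] planeWaves M b Y) {t : ℝ} (ht : 0 ≤ t) :
    freeSemigroup hα t u =ᵐ[volume]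
      planeWaves M (fun ω => b ω * Complex.exp (t * (α * (Y ω : ℂ) ^ p))) Y := by
  have hg : MemLp (planeWaves M b Y) 2 volume := (memLp_congr_ae hu).1 (Lp.memLp u)
  rw [Lp.ext (hu.trans hg.coeFn_toLp.symm)]
  exact freeSemigroup_planeWaves hα hb hY hg ht

/-- The terms of the Dyson series as integrals over simplices. -/
theorem boundedDyson_ae_eq (hc₀ : Measurable c₀) (hc : Measurable c)
    (hi₀ : Integrable c₀ m₀) (hi : Integrable c m) {V : ℝ → ℂ} (hVm : AEStronglyMeasurable V) {C : ℝ}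
    (hVC : ∀ x, ‖V x‖ ≤ C) (hV : V = planeWaves m c id) {u : L2R}
    (hu : u =ᵐ[volume] planeWaves m₀ c₀ id) (n : ℕ) (t : ℝ≥0) :
    (boundedDyson (freeSemigroup hα) (boundedMul hVm hVC) n t u : L2R) =ᵐ[volume]
      fun x => ∫ s in timeSimplex n t, pathAmplitude p α m₀ m c₀ c t x s := by
  induction n generalizing t with
  | zero =>
    have hu' : u =ᵐ[volume] planeWaves (freqMeasure m₀ m 0) (freqWeight c₀ c) freqSum := by
      filter_upwards [hu] with x hx
      rw [hx, planeWaves_freqMeasure, pow_zero, mul_one]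
    refine (freeSemigroup_of_ae_eq_planeWaves hα (integrable_freqWeight hi₀ hi 0)
      measurable_freqSum hu' t.coe_nonneg).trans (ae_of_all _ fun x => ?_)
    simp only [setIntegral_timeSimplex_zero, pathAmplitude]
    congr 1
    funext a
    rw [pathPhase_rampSum]
    simp only [freqSum, Finset.univ_eq_empty, Finset.sum_empty, add_zero,
      intervalIntegral.integral_const, sub_zero, smul_eq_mul]
    push_cast
    ring_nf
  | succ n ih =>
    have hE : IsContractionFamily (freeSemigroup hα) :=
      isContractionFamily_fourierExpMul measurable_freeSymbol (re_freeSymbol_nonpos hα)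
    have hamp := measurable_pathAmplitude (p := p) (α := α) (m₀ := m₀) (m := m) hc₀ hc (n + 1) t
    have hG : Measurable (Function.uncurry fun r x =>
        timeSlice n t (pathAmplitude p α m₀ m c₀ c t x) r) := measurable_timeSlice n t hamp
    -- The Duhamel integrand at time `r` has to be matched with the slice of the simplex at last
    -- time `r`. By induction the term of order `n` is a superposition; `V` appends a frequency, and
    -- the free semigroup for time `t - r` contributes exactly the phase accumulated after `r`.
    have key := coeFn_intervalIntegral_L2 t.coe_nonneg
      (Φ := fun r => freeSemigroup hα (t - r) (boundedMul hVm hVC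
        (boundedDyson (freeSemigroup hα) (boundedMul hVm hVC) n r u)))
      (intervalIntegrable_duhamel hE _ (continuous_boundedDyson hE _ n u) t 0 t) hG
      (fun r hr x => norm_timeSlice_le n t
        (fun s => norm_pathAmplitude_le hα t x s hi₀ hi) hr) (fun r hr => ?_)
    · refine key.trans (ae_of_all _ fun x => (setIntegral_timeSimplex_succ n t ?_).symm)
      have hx : Measurable (pathAmplitude p α m₀ m c₀ c t x (n := n + 1)) :=
        hamp.of_uncurry_left
      exact integrableOn_timeSimplex (n + 1) t hx fun s => norm_pathAmplitude_le hα t x s hi₀ hi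
    · lift r to ℝ≥0 using hr.1
      have hr' : r ≤ t := by exact_mod_cast hr.2
      have hfs : Measurable fun z : ((Fin n → ℝ) × ℝ × (Fin n → ℝ)) × ℝ => freqSum z.1.2 + z.2 :=
        (measurable_freqSum.comp (measurable_snd.comp measurable_fst)).add measurable_snd
      have hint : Integrable (fun z : ((Fin n → ℝ) × ℝ × (Fin n → ℝ)) × ℝ => freqWeight c₀ c z.1.2 *
            Complex.exp (pathPhase p α (rampSum p r z.1.1 z.1.2.1 z.1.2.2)) * c z.2)
          ((dysonMeasure m₀ m n r).prod m) :=
        (integrable_dysonWeight_mul_exp hα hi₀ hi n r r).mul_prod hi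
      have hB : boundedMul hVm hVC (boundedDyson (freeSemigroup hα) (boundedMul hVm hVC) n r u)
          =ᵐ[volume] planeWaves ((dysonMeasure m₀ m n r).prod m) (fun z => freqWeight c₀ c z.1.2 *
            Complex.exp (pathPhase p α (rampSum p r z.1.1 z.1.2.1 z.1.2.2)) * c z.2)
            (fun z => freqSum z.1.2 + z.2) := by
        filter_upwards [coeFn_boundedMul hVm hVC
          (boundedDyson (freeSemigroup hα) (boundedMul hVm hVC) n r u), ih r] with x h1 h2
        rw [h1, h2, setIntegral_pathAmplitude hα hi₀ hi, hV, mul_comm]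
        exact planeWaves_mul _ _ _ _ x
      have h1 := freeSemigroup_of_ae_eq_planeWaves hα hint hfs hB (sub_nonneg.2 hr.2)
      filter_upwards [h1] with x hx
      exact hx.trans (timeSlice_pathAmplitude hα hc₀ hc hi₀ hi n hr' x).symm

end Amplitude

/-! ### Fresnel integrals of cylinder and Feynman–Kac functionals -/

section Fresnel

/-- The one-term case of the superposition, obtained by taking the zero measure for all other
indices. -/
theorem exists_complexMeasure_integral_eq {E Ω : Type*} [MeasurableSpace E] [MeasurableSpace Ω]
    (M : Measure Ω) (Y : Ω → E) (c : Ω → ℂ) (hY : Measurable Y) (hc : Measurable c)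
    (hi : Integrable c M) :
    ∃ μ : ComplexMeasure E, ∀ F : E → ℂ, Measurable F → (∃ C, ∀ x, ‖F x‖ ≤ C) →
      cIntegral μ F = ∫ ω, F (Y ω) * c ω ∂M := by
  have h0 : ∀ n : ℕ, n ≠ 0 → (if n = 0 then M else 0) = 0 := fun n hn => if_neg hn
  obtain ⟨μ, hμ⟩ := exists_complexMeasure_hasSum
    (fun n : ℕ => if n = 0 then M else 0) (fun _ => Y) (fun _ => c) (fun _ => hY) (fun _ => hc)
    (fun n => by
      rcases eq_or_ne n 0 with rfl | hn
      · simpa using hi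
      · simp [hn])
    (summable_of_ne_finset_zero (s := {0}) fun n hn => by
      rw [h0 n (by simpa using hn), integral_zero_measure])
  refine ⟨μ, fun F hF hC => (hμ F hF hC).unique ?_⟩
  have h := hasSum_single (f := fun n : ℕ => ∫ ω, F (Y ω) * c ω ∂(if n = 0 then M else 0)) 0
    fun n hn => by rw [h0 n hn, integral_zero_measure]
  simpa using h

theorem PathSpace.continuous_eval {r : ℝ≥0∞} {t : ℝ≥0} (η : PathSpace r t) :
    Continuous η.eval := by
  have h := η.isPath.1.continuousOn
  rw [uIcc_of_le t.coe_nonneg, continuousOn_iff_continuous_domRestrict] at h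
  refine Continuous.Icc_extend' (h.congr fun s => ?_)
  simp [pathExtend]

theorem exists_planeWaves_of_mem_fourierClassReal {f : ℝ → ℂ} (hf : f ∈ FourierClassReal) :
    ∃ (m : Measure ℝ) (c : ℝ → ℂ), IsFiniteMeasure m ∧ Measurable c ∧ Integrable c m ∧
      f = planeWaves m c id := by
  obtain ⟨μ, rfl⟩ := hf
  obtain ⟨m, c, hm, hc, hi, rfl⟩ := ComplexMeasure.exists_withDensity μ
  refine ⟨m, c, hm, hc, hi, funext fun x => ?_⟩
  rw [measureFourier, cIntegral_withDensityᵥ hi (by fun_prop)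
    (fun y => (norm_exp_I_mul_ofReal (x * y)).le)]
  exact integral_congr_ae (ae_of_all _ fun y => mul_comm _ _)

variable {p : ℕ} [Fact (2 ≤ p)] {q : ℝ≥0∞} [Fact (1 ≤ q)] [ENNReal.HolderConjugate (p : ℝ≥0∞) q]
  {α : ℂ} {t : ℝ≥0}

theorem measurable_exp_pathPairing (η : PathSpace q t) : Measurable fun γ : PathSpace (p : ℝ≥0∞) t =>
    Complex.exp (Complex.I * (pathPairing η γ : ℂ)) := by
  have h : Continuous fun γ : PathSpace (p : ℝ≥0∞) t => pathPairing η γ := by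
    simp only [← pathPairingL_apply]
    fun_prop
  exact (by fun_prop : Continuous fun γ : PathSpace (p : ℝ≥0∞) t =>
    Complex.exp (Complex.I * (pathPairing η γ : ℂ))).measurable

variable (hα : ∀ t : ℝ, 0 ≤ t → ∀ x : ℝ, ‖Complex.exp (α * t * x ^ p)‖ ≤ 1)

theorem measurable_exp_pathPhase : Measurable fun γ : PathSpace (p : ℝ≥0∞) t =>
    Complex.exp (pathPhase p α γ) :=
  (Complex.continuous_exp.comp (continuous_pathPhase p α)).measurable

theorem pathFresnel_measureFourier (μ : ComplexMeasure (PathSpace (p : ℝ≥0∞) t)) :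
    pathFresnel p q α t (measureFourier pathPairing μ) =
      cIntegral μ fun γ => Complex.exp (pathPhase p α γ) := by
  have : Fact ((p : ℝ≥0∞) ≠ ∞) := ⟨ENNReal.natCast_ne_top p⟩
  exact fresnelIntegral_measureFourier_of_injective pathMeasureFourier_injective _ μ

set_option linter.unusedSectionVars false

variable {m₀ m : Measure ℝ} [IsFiniteMeasure m₀] [IsFiniteMeasure m] {c₀ c : ℝ → ℂ}

/-- The density on times and frequencies that represents the functionals based at `x`. -/
def shiftedWeight (c₀ c : ℝ → ℂ) (x : ℝ) {n : ℕ} (a : ℝ × (Fin n → ℝ)) : ℂ :=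
  freqWeight c₀ c a * Complex.exp (Complex.I * ((x * freqSum a : ℝ) : ℂ))

theorem measurable_shiftedWeight (hc₀ : Measurable c₀) (hc : Measurable c) (x : ℝ) (n : ℕ) :
    Measurable (shiftedWeight c₀ c x (n := n)) := by
  have := measurable_freqSum (n := n)
  exact (measurable_freqWeight hc₀ hc).mul (by fun_prop)

theorem norm_shiftedWeight (x : ℝ) {n : ℕ} (a : ℝ × (Fin n → ℝ)) :
    ‖shiftedWeight c₀ c x a‖ = ‖freqWeight c₀ c a‖ := by
  rw [shiftedWeight, norm_mul, norm_exp_I_mul_ofReal, mul_one]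

theorem integrable_shiftedWeight (hc₀ : Measurable c₀) (hc : Measurable c)
    (hi₀ : Integrable c₀ m₀) (hi : Integrable c m) (x : ℝ) (n : ℕ) :
    Integrable (shiftedWeight c₀ c x) (freqMeasure m₀ m n) :=
  (integrable_freqWeight hi₀ hi n).mono
    (measurable_shiftedWeight hc₀ hc x n).aestronglyMeasurable
    (ae_of_all _ fun a => (norm_shiftedWeight x a).le)

/-- The base point `x` enters only through a phase factor in the weight; the paths do not depend on
it. -/
theorem integral_exp_pathPairing_mul_shiftedWeight {n : ℕ} {s : Fin n → ℝ}
    (hs : s ∈ timeSimplex n t) (x : ℝ) (η : PathSpace q t) :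
    ∫ a, Complex.exp (Complex.I * (pathPairing η (rampSum (p : ℝ≥0∞) t s a.1 a.2) : ℂ)) *
      shiftedWeight c₀ c x a ∂(freqMeasure m₀ m n) =
      cylinderFunctional q (planeWaves m₀ c₀ id) (planeWaves m c id) t x s η := by
  rw [cylinderFunctional, ← integral_freqWeight_mul_exp]
  congr 1
  funext a
  rw [pathPairing_rampSum η hs.1, shiftedWeight, mul_left_comm, ← Complex.exp_add, ← mul_add,
    ← Complex.ofReal_add]
  congr 4
  simp only [freqSum, mul_add, add_mul, Finset.sum_add_distrib, Finset.mul_sum]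
  have e : ∀ i, a.2 i * η.eval (s i) = η.eval (s i) * a.2 i := fun i => mul_comm _ _
  simp only [e]
  ring

theorem integral_exp_pathPhase_mul_shiftedWeight {n : ℕ} (s : Fin n → ℝ) (x : ℝ) :
    ∫ a, Complex.exp (pathPhase p α (rampSum p t s a.1 a.2)) *
      shiftedWeight c₀ c x a ∂(freqMeasure m₀ m n) = pathAmplitude p α m₀ m c₀ c t x s := by
  rw [pathAmplitude, planeWaves]
  congr 1
  funext a
  rw [shiftedWeight]
  ring

variable (hc₀ : Measurable c₀) (hc : Measurable c) (hi₀ : Integrable c₀ m₀) (hi : Integrable c m)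

include hα hc₀ hc hi₀ hi

/-- The image of the weighted frequency measure under `rampSum` represents the functional.
Integrating `exp (i ⟨η, ·⟩)` against it returns the functional, and integrating `exp Φ` returns the
amplitude. -/
theorem cylinderFunctional_fresnel {n : ℕ} {s : Fin n → ℝ} (hs : s ∈ timeSimplex n t) (x : ℝ) :
    cylinderFunctional q (planeWaves m₀ c₀ id) (planeWaves m c id) t x s ∈
      FourierClass (pathPairing (q := q) (p := (p : ℝ≥0∞)) (t := t)) ∧
    pathFresnel p q α t (cylinderFunctional q (planeWaves m₀ c₀ id) (planeWaves m c id) t x s) =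
      pathAmplitude p α m₀ m c₀ c t x s := by
  have hY : Measurable fun a : ℝ × (Fin n → ℝ) => rampSum (p : ℝ≥0∞) t s a.1 a.2 :=
    ((continuous_rampSum (ENNReal.natCast_ne_top p) n).comp
      (by fun_prop : Continuous fun a : ℝ × (Fin n → ℝ) => (s, a.1, a.2))).measurable
  obtain ⟨μ, hμ⟩ := exists_complexMeasure_integral_eq (freqMeasure m₀ m n) _ _ hY
    (measurable_shiftedWeight hc₀ hc x n) (integrable_shiftedWeight hc₀ hc hi₀ hi x n)
  have e : measureFourier pathPairing μ =
      cylinderFunctional q (planeWaves m₀ c₀ id) (planeWaves m c id) t x s := by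
    funext η
    rw [measureFourier, hμ _ (measurable_exp_pathPairing η)
      ⟨1, fun γ => (norm_exp_I_mul_ofReal _).le⟩]
    exact integral_exp_pathPairing_mul_shiftedWeight hs x η
  rw [← e]
  refine ⟨⟨μ, rfl⟩, ?_⟩
  rw [pathFresnel_measureFourier, hμ _ measurable_exp_pathPhase
    ⟨1, fun γ => norm_exp_pathPhase_le p hα γ⟩]
  exact integral_exp_pathPhase_mul_shiftedWeight s x

/-- The representing measures of all orders are superposed, with times integrated over the simplex;
the volume `t^n / n!` makes the total masses summable. Testing with `exp (i ⟨η, ·⟩)` recovers the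
exponential series, and testing with `exp Φ` gives the series of amplitudes. -/
theorem feynmanKacFunctional_fresnel (x : ℝ) :
    feynmanKacFunctional q (planeWaves m₀ c₀ id) (planeWaves m c id) t x ∈
      FourierClass (pathPairing (q := q) (p := (p : ℝ≥0∞)) (t := t)) ∧
    HasSum (fun n => ∫ s in timeSimplex n t, pathAmplitude p α m₀ m c₀ c t x s)
      (pathFresnel p q α t
        (feynmanKacFunctional q (planeWaves m₀ c₀ id) (planeWaves m c id) t x)) := by
  have hY : ∀ n, Measurable fun b : (Fin n → ℝ) × ℝ × (Fin n → ℝ) =>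
      rampSum (p : ℝ≥0∞) t b.1 b.2.1 b.2.2 := fun n =>
    (continuous_rampSum (ENNReal.natCast_ne_top p) n).measurable
  have hw : ∀ n, Measurable fun b : (Fin n → ℝ) × ℝ × (Fin n → ℝ) => shiftedWeight c₀ c x b.2 :=
    fun n => (measurable_shiftedWeight hc₀ hc x n).comp measurable_snd
  have hwi : ∀ n, Integrable (fun b => shiftedWeight c₀ c x b.2) (dysonMeasure m₀ m n t) :=
    fun n => (integrable_shiftedWeight hc₀ hc hi₀ hi x n).comp_snd _
  have hnorm : ∀ n, ∫ b, ‖shiftedWeight c₀ c x b.2‖ ∂(dysonMeasure m₀ m n t) =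
      (∫ y, ‖c₀ y‖ ∂m₀) * (t * ∫ y, ‖c y‖ ∂m) ^ n / n.factorial := fun n => by
    simp only [norm_shiftedWeight]
    rw [dysonMeasure, integral_fun_snd (fun a => ‖freqWeight c₀ c a‖), integral_norm_freqWeight, measureReal_restrict_apply_univ,
      volume_real_timeSimplex, smul_eq_mul, mul_pow]
    ring
  obtain ⟨μ, hμ⟩ := exists_complexMeasure_hasSum (fun n => dysonMeasure m₀ m n t)
    (fun n b => rampSum (p : ℝ≥0∞) t b.1 b.2.1 b.2.2) (fun n b => shiftedWeight c₀ c x b.2)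
    hY hw hwi (by simpa only [hnorm] using summable_dysonBound _ _)
  have hprod : ∀ (F : PathSpace (p : ℝ≥0∞) t → ℂ), Measurable F → (∀ γ, ‖F γ‖ ≤ 1) → ∀ n,
      ∫ b, F (rampSum p t b.1 b.2.1 b.2.2) * shiftedWeight c₀ c x b.2 ∂(dysonMeasure m₀ m n t) =
      ∫ s in timeSimplex n t, ∫ a, F (rampSum p t s a.1 a.2) * shiftedWeight c₀ c x a
        ∂(freqMeasure m₀ m n) := fun F hF hF1 n =>
    integral_prod _ ((hwi n).bdd_mul (c := 1) (hF.comp (hY n)).aestronglyMeasurable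
      (ae_of_all _ fun b => hF1 _))
  have e : measureFourier pathPairing μ =
      feynmanKacFunctional q (planeWaves m₀ c₀ id) (planeWaves m c id) t x := by
    funext η
    have hF1 : ∀ γ : PathSpace (p : ℝ≥0∞) t,
        ‖Complex.exp (Complex.I * (pathPairing η γ : ℂ))‖ ≤ 1 :=
      fun γ => (norm_exp_I_mul_ofReal _).le
    have h1 := hμ _ (measurable_exp_pathPairing η) ⟨1, hF1⟩
    refine h1.unique ?_
    have hV : Continuous fun s => planeWaves m c id (x + η.eval s) :=
      (continuous_planeWaves hi measurable_id).comp (continuous_const.add η.continuous_eval)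
    have h2 := (NormedSpace.expSeries_div_hasSum_exp
      (∫ s in (0 : ℝ)..t, planeWaves m c id (x + η.eval s))).mul_left
      (planeWaves m₀ c₀ id (x + η.eval 0))
    rw [← Complex.exp_eq_exp_ℂ] at h2
    refine h2.congr_fun fun n => ?_
    rw [hprod _ (measurable_exp_pathPairing η) hF1, ← setIntegral_timeSimplex_prod n t hV,
      ← integral_const_mul]
    exact setIntegral_congr_fun (measurableSet_timeSimplex n t) fun s hs =>
      integral_exp_pathPairing_mul_shiftedWeight hs x η
  rw [← e]
  refine ⟨⟨μ, rfl⟩, ?_⟩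
  rw [pathFresnel_measureFourier]
  have h1 := hμ _ measurable_exp_pathPhase ⟨1, fun γ => norm_exp_pathPhase_le p hα γ⟩
  convert h1 using 2 with n
  rw [hprod _ measurable_exp_pathPhase fun γ => norm_exp_pathPhase_le p hα γ]
  simp only [integral_exp_pathPhase_mul_shiftedWeight]

end Fresnel

/-! ### The free and the perturbed semigroup -/

section Generator

variable {p : ℕ} {α : ℂ} (hα : ∀ t : ℝ, 0 ≤ t → ∀ x : ℝ, ‖Complex.exp (α * t * x ^ p)‖ ≤ 1)

theorem isContractionFamily_freeSemigroup : IsContractionFamily (freeSemigroup hα) :=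
  isContractionFamily_fourierExpMul measurable_freeSymbol (re_freeSymbol_nonpos hα)

theorem isGenerator_freeSemigroup : IsGenerator (freeOp p α) (freeSemigroup hα) :=
  isGenerator_fourierExpMul measurable_freeSymbol (re_freeSymbol_nonpos hα)

theorem isGenerator_perturbed_mulOp {A : L2R →ₗ.[ℂ] L2R} {E : ℝ → L2R →L[ℂ] L2R}
    (hE : IsContractionFamily E) (hA : IsGenerator A E) {V : ℝ → ℂ} (hm : AEStronglyMeasurable V)
    {C : ℝ} (hC : ∀ x, ‖V x‖ ≤ C) :
    IsGenerator (A + mulOp V) (perturbed hE (boundedMul hm hC)) := fun u v => by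
  rw [mem_graph_add_mulOp A hm hC, hA]
  exact (tendsto_perturbed_iff hE (boundedMul hm hC) u v).symm

/-- Since `V` is bounded, the default value `0` in `mulL2` is never used. -/
theorem dysonTerm_eq_boundedDyson (E : ℝ → L2R →L[ℂ] L2R) {V : ℝ → ℂ}
    (hm : AEStronglyMeasurable V) {C : ℝ} (hC : ∀ x, ‖V x‖ ≤ C) (n : ℕ) (t : ℝ) (u : L2R) :
    dysonTerm E V n t u = boundedDyson E (boundedMul hm hC) n t u := by
  induction n generalizing t with
  | zero => rfl
  | succ n ih =>
    simp only [dysonTerm, boundedDyson]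
    refine intervalIntegral.integral_congr fun s _ => ?_
    rw [ih, mulL2_eq_boundedMul hm hC]

end Generator

/-! ### Comparison of the `L²` sum with the pointwise sum -/

section Identification

/-- A series that converges in `L²` and pointwise has the same sum in both senses. -/
theorem ae_eq_of_hasSum_L2 {f : ℕ → L2R} {g : L2R} (hf : HasSum f g) {F : ℕ → ℝ → ℂ} {G : ℝ → ℂ}
    (hF : ∀ n, f n =ᵐ[volume] F n) (hG : ∀ x, HasSum (fun n => F n x) (G x)) :
    G =ᵐ[volume] g := by
  have h1 := hf.tendsto_sum_nat
  -- A subsequence of the partial sums converges almost everywhere to the `L²` sum, and it also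
  -- converges to the pointwise sum.
  obtain ⟨φ, hφ, h2⟩ := (tendstoInMeasure_of_tendsto_Lp h1).exists_seq_tendsto_ae
  have h3 : ∀ᵐ x, ∀ n, (∑ i ∈ Finset.range n, f i : L2R) x = ∑ i ∈ Finset.range n, F i x := by
    refine ae_all_iff.2 fun n => ?_
    induction n with
    | zero =>
      exact ae_of_all _ fun x => by simp
    | succ n ih =>
      rw [Finset.sum_range_succ]
      filter_upwards [ih, hF n, Lp.coeFn_add (∑ i ∈ Finset.range n, f i) (f n)] with x h1 h2 h3
      rw [h3, Pi.add_apply, h1, h2, Finset.sum_range_succ]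
  filter_upwards [h2, h3] with x hx2 hx3
  simp only [hx3] at hx2
  exact tendsto_nhds_unique ((hG x).tendsto_sum_nat.comp hφ.tendsto_atTop) hx2

end Identification

end

/-! ### The main theorem -/

theorem mainTheorem1 (p : ℕ) [Fact (2 ≤ p)] (q : ℝ≥0∞) [ENNReal.HolderConjugate (p : ℝ≥0∞) q]
    (α : ℂ) (hα : ∀ t : ℝ, 0 ≤ t → ∀ x : ℝ, ‖Complex.exp (α * t * x ^ p)‖ ≤ 1)
    (V : ℝ → ℂ) (hV : V ∈ FourierClassReal) :
    -- the Fresnel integral does not depend on the choice of the representing measure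
    (∀ (t : ℝ≥0) (μ : ComplexMeasure (PathSpace (p : ℝ≥0∞) t)),
      pathFresnel p q α t (measureFourier pathPairing μ) =
        cIntegral μ fun γ => Complex.exp (pathPhase p α γ)) ∧
    -- `A` and `A + B` generate strongly continuous semigroups `E` and `T`
    ∃ E T : ℝ → L2R →L[ℂ] L2R,
      IsC0Semigroup E ∧ IsGenerator (freeOp p α) E ∧
      IsC0Semigroup T ∧ IsGenerator (freeOp p α + mulOp V) T ∧
      ∀ (u₀ : ℝ → ℂ) (_ : u₀ ∈ FourierClassReal) (hu₀ : MemLp u₀ 2 volume) (t : ℝ≥0),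
        -- the functional belongs to `F(B_q)`
        (∀ x, feynmanKacFunctional q u₀ V t x ∈
          FourierClass (pathPairing (q := q) (p := (p : ℝ≥0∞)) (t := t))) ∧
        -- its Fresnel integral is the solution
        ((fun x => pathFresnel p q α t (feynmanKacFunctional q u₀ V t x))
          =ᵐ[volume] T t (hu₀.toLp u₀)) ∧
        -- term by term identification with the Dyson series
        HasSum (fun n => dysonTerm E V n t (hu₀.toLp u₀)) (T t (hu₀.toLp u₀)) ∧
        (∀ x, HasSum (fun n => ∫ s in timeSimplex n t,
            pathFresnel p q α t (cylinderFunctional q u₀ V t x s))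
          (pathFresnel p q α t (feynmanKacFunctional q u₀ V t x))) ∧
        ∀ n : ℕ,
          (∀ x, ∀ s ∈ timeSimplex n t, cylinderFunctional q u₀ V t x s ∈
            FourierClass (pathPairing (q := q) (p := (p : ℝ≥0∞)) (t := t))) ∧
          (∀ x, IntegrableOn (fun s => pathFresnel p q α t (cylinderFunctional q u₀ V t x s))
            (timeSimplex n t)) ∧
          (fun x => ∫ s in timeSimplex n t,
              pathFresnel p q α t (cylinderFunctional q u₀ V t x s))
            =ᵐ[volume] dysonTerm E V n t (hu₀.toLp u₀) := by
  have : Fact (1 ≤ q) := ⟨(ENNReal.HolderConjugate.symm (p := (p : ℝ≥0∞)) (q := q)).one_le⟩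
  obtain ⟨m, c, hm, hc, hi, hVm⟩ := exists_planeWaves_of_mem_fourierClassReal hV
  have hVc : AEStronglyMeasurable V := by
    rw [hVm]
    exact (continuous_planeWaves hi measurable_id).aestronglyMeasurable
  have hVC : ∀ x, ‖V x‖ ≤ ∫ y, ‖c y‖ ∂m := fun x => by
    rw [hVm]
    exact norm_planeWaves_le x
  have hE := isContractionFamily_freeSemigroup hα
  -- Both semigroups are fixed before the initial datum and the time; only the representation of
  -- `u₀` by plane waves is chosen afterwards.
  refine ⟨fun t μ => pathFresnel_measureFourier μ, freeSemigroup hα,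
    perturbed hE (boundedMul hVc hVC), hE.isC0Semigroup, isGenerator_freeSemigroup hα,
    isC0Semigroup_perturbed hE _,
    isGenerator_perturbed_mulOp hE (isGenerator_freeSemigroup hα) hVc hVC,
    fun u₀ hu₀F hu₀ t => ?_⟩
  obtain ⟨m₀, c₀, hm₀, hc₀, hi₀, hu⟩ := exists_planeWaves_of_mem_fourierClassReal hu₀F
  have hu₀' : hu₀.toLp u₀ =ᵐ[volume] planeWaves m₀ c₀ id := hu₀.coeFn_toLp.trans (by rw [hu])
  have hcyl : ∀ (n : ℕ) (x : ℝ), ∀ s ∈ timeSimplex n t, cylinderFunctional q u₀ V t x s ∈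
        FourierClass (pathPairing (q := q) (p := (p : ℝ≥0∞)) (t := t)) ∧
      pathFresnel p q α t (cylinderFunctional q u₀ V t x s) =
        pathAmplitude p α m₀ m c₀ c t x s := fun n x s hs => by
    rw [hu, hVm]
    exact cylinderFunctional_fresnel hα hc₀ hc hi₀ hi hs x
  have hfk : ∀ x : ℝ, feynmanKacFunctional q u₀ V t x ∈
        FourierClass (pathPairing (q := q) (p := (p : ℝ≥0∞)) (t := t)) ∧
      HasSum (fun n => ∫ s in timeSimplex n t, pathAmplitude p α m₀ m c₀ c t x s)
        (pathFresnel p q α t (feynmanKacFunctional q u₀ V t x)) := fun x => by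
    rw [hu, hVm]
    exact feynmanKacFunctional_fresnel hα hc₀ hc hi₀ hi x
  have hint : ∀ (n : ℕ) (x : ℝ), ∫ s in timeSimplex n t,
      pathFresnel p q α t (cylinderFunctional q u₀ V t x s) =
        ∫ s in timeSimplex n t, pathAmplitude p α m₀ m c₀ c t x s := fun n x =>
    setIntegral_congr_fun (measurableSet_timeSimplex n t) fun s hs => (hcyl n x s hs).2
  have hdyson : ∀ n, (dysonTerm (freeSemigroup hα) V n t (hu₀.toLp u₀) : L2R) =ᵐ[volume]
      fun x => ∫ s in timeSimplex n t, pathAmplitude p α m₀ m c₀ c t x s := fun n => by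
    rw [dysonTerm_eq_boundedDyson _ hVc hVC]
    exact boundedDyson_ae_eq hα hc₀ hc hi₀ hi hVc hVC hVm hu₀' n t
  have hsum : HasSum (fun n => dysonTerm (freeSemigroup hα) V n t (hu₀.toLp u₀))
      (perturbed hE (boundedMul hVc hVC) t (hu₀.toLp u₀)) := by
    simp only [dysonTerm_eq_boundedDyson _ hVc hVC]
    exact hasSum_perturbed hE _ _ t.coe_nonneg
  refine ⟨fun x => (hfk x).1, ?_, hsum, fun x => ?_, fun n => ⟨fun x s hs => (hcyl n x s hs).1,
    fun x => ?_, ?_⟩⟩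
  · exact ae_eq_of_hasSum_L2 hsum hdyson fun x => (hfk x).2
  · simpa only [hint] using (hfk x).2
  · refine (integrableOn_timeSimplex n t (measurable_pathAmplitude (p := p) (α := α) (m₀ := m₀)
      (m := m) hc₀ hc n t).of_uncurry_left
      fun s => norm_pathAmplitude_le hα t x s hi₀ hi).congr_fun
      (fun s hs => (hcyl n x s hs).2.symm) (measurableSet_timeSimplex n t)
  · simp only [hint]
    exact (hdyson n).symm
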